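/- Let $\mathfrak H=\ell^2(\mathbb N_0,L^2(\mathbb R))$ be the Hilbert space of square-summable sequences $U\sim\{u_n\}_{n\ge 0}$ of functions $u_n\in L^2(\mathbb R)$ (complex-valued). Let $$\mathcal W(\mathbb R)=\{u\in C(\mathbb R): u|_{(0,\infty)}\in H^2(0,\infty),\ u|_{(-\infty,0)}\in H^2(-\infty,0)\},$$ and for $u\in\mathcal W(\mathbb R)$ put $(Lu)(x)=-u''(x)+\tfrac12u(x)$, $x\ne0$. For $\alpha>0$ let $\mu=\sqrt2/\alpha$, and let $\mathcal D_\alpha\subset\mathfrak H$ be the set of all $U\sim\{u_n\}\in\mathfrak H$ such that $u_n\in\mathcal W(\mathbb R)$ for every $n\in\mathbb N_0$, the matching conditions $$\mu\bigl(u_n'(0+)-u_n'(0-)\bigr)=\sqrt{n+1}\,u_{n+1}(0)+\sqrt n\,u_{n-1}(0),\qquad n\in\mathbb N_0,$$ hold (for $n=0$ the last term is absent), and $\sum_{n\ge0}\|(L+n)u_n\|_{L^2(\mathbb R)}^2<\infty$. Let $\mathbf A_\alpha$ be the operator in $\mathfrak H$ with domain $\mathcal D_\alpha$ given by $\mathbf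 A_\alpha U\sim\{(L+n)u_n\}$, and let $\mathbf A_\alpha^0$ be its restriction to the set of those $U\in\mathcal D_\alpha$ which have only finitely many non-zero components. Then for every $\alpha>0$ the operator $\mathbf A_\alpha$ is self-adjoint in $\mathfrak H$, and it coincides with the closure of $\mathbf A_\alpha^0$ (in particular, $\mathbf A_\alpha^0$ is closable). -/

import Mathlib

noncomputable section

namespace Smilansky

open MeasureTheory Set Filter Topology
open scoped ContDiff ENNReal

/-- `v` is the weak (distributional) derivative of `u` on the open set `I ⊆ ℝ`. -/
def HasWeakDerivOn (I : Set ℝ) (u v : ℝ → ℂ) : Prop :=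
  LocallyIntegrableOn u I volume ∧ LocallyIntegrableOn v I volume ∧
    ∀ φ : ℝ → ℝ, ContDiff ℝ ∞ φ → HasCompactSupport φ → tsupport φ ⊆ I →
      ∫ x in I, deriv φ x • u x = - ∫ x in I, φ x • v x

/-- `u` restricted to `I` lies in the Sobolev space `H²(I)`:
`u` and its first and second weak derivatives on `I` are in `L²(I)`. -/
def MemH2 (I : Set ℝ) (u : ℝ → ℂ) : Prop :=
  MemLp u 2 (volume.restrict I) ∧
    ∃ v w : ℝ → ℂ, MemLp v 2 (volume.restrict I) ∧ MemLp w 2 (volume.restrict I) ∧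
      HasWeakDerivOn I u v ∧ HasWeakDerivOn I v w

/-- `f ∈ L²(ℝ)` is the second derivative of `u` away from the point `0`
(no derivative across `0` is taken, so a jump of `u'` at `0` does not contribute). -/
def IsSecondDeriv (u : ℝ → ℂ) (f : Lp ℂ 2 (volume : Measure ℝ)) : Prop :=
  (∃ v, HasWeakDerivOn (Iio 0) u v ∧ HasWeakDerivOn (Iio 0) v f) ∧
    ∃ v, HasWeakDerivOn (Ioi 0) u v ∧ HasWeakDerivOn (Ioi 0) v f

/-- `u'(0+) = a`: some version of the derivative of `u` on `(0, ∞)` tends to `a` at `0`. -/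
def HasDerivRight (u : ℝ → ℂ) (a : ℂ) : Prop :=
  ∃ v, HasWeakDerivOn (Ioi 0) u v ∧ Tendsto v (𝓝[>] 0) (𝓝 a)

/-- `u'(0-) = b`: some version of the derivative of `u` on `(-∞, 0)` tends to `b` at `0`. -/
def HasDerivLeft (u : ℝ → ℂ) (b : ℂ) : Prop :=
  ∃ v, HasWeakDerivOn (Iio 0) u v ∧ Tendsto v (𝓝[<] 0) (𝓝 b)

section WeakDeriv

variable {I : Set ℝ} {u v u₁ v₁ u₂ v₂ : ℝ → ℂ}

lemma integrableOn_smul (hI : IsOpen I) (hu : LocallyIntegrableOn u I volume)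
    {ψ : ℝ → ℝ} (hψ : Continuous ψ) (hc : HasCompactSupport ψ) (hs : tsupport ψ ⊆ I) :
    IntegrableOn (fun x => ψ x • u x) I volume := by
  have h : LocallyIntegrableOn (fun x => ψ x • u x) I volume :=
    hu.continuousOn_smul hI.isLocallyClosed hψ.continuousOn
  have h1 : IntegrableOn (fun x => ψ x • u x) (tsupport ψ) volume :=
    h.integrableOn_compact_subset hs hc
  have h2 : Integrable (fun x => ψ x • u x) volume := by
    refine (integrableOn_iff_integrable_of_support_subset ?_).1 h1
    intro x hx
    refine subset_tsupport ψ ?_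
    intro h0
    exact hx (by simp [h0])
  exact h2.integrableOn

lemma integrableOn_deriv_smul (hI : IsOpen I) (hu : LocallyIntegrableOn u I volume)
    {φ : ℝ → ℝ} (hφ : ContDiff ℝ ∞ φ) (hc : HasCompactSupport φ) (hs : tsupport φ ⊆ I) :
    IntegrableOn (fun x => deriv φ x • u x) I volume :=
  integrableOn_smul hI hu (hφ.continuous_deriv (by simp)) hc.deriv
    ((closure_minimal support_deriv_subset (isClosed_tsupport φ)).trans hs)

lemma HasWeakDerivOn.add (hI : IsOpen I) (h₁ : HasWeakDerivOn I u₁ v₁)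
    (h₂ : HasWeakDerivOn I u₂ v₂) : HasWeakDerivOn I (u₁ + u₂) (v₁ + v₂) := by
  refine ⟨h₁.1.add h₂.1, h₁.2.1.add h₂.2.1, fun φ hφ hc hs => ?_⟩
  simp only [Pi.add_apply, smul_add]
  rw [integral_add (integrableOn_deriv_smul hI h₁.1 hφ hc hs)
      (integrableOn_deriv_smul hI h₂.1 hφ hc hs),
    integral_add (integrableOn_smul hI h₁.2.1 hφ.continuous hc hs)
      (integrableOn_smul hI h₂.2.1 hφ.continuous hc hs),
    h₁.2.2 φ hφ hc hs, h₂.2.2 φ hφ hc hs]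
  ring

lemma HasWeakDerivOn.smul (c : ℂ) (h : HasWeakDerivOn I u v) :
    HasWeakDerivOn I (c • u) (c • v) := by
  refine ⟨h.1.smul c, h.2.1.smul c, fun φ hφ hc hs => ?_⟩
  simp only [Pi.smul_apply, smul_comm _ c]
  rw [integral_smul, integral_smul, h.2.2 φ hφ hc hs, smul_neg]

lemma HasWeakDerivOn.zero : HasWeakDerivOn I 0 0 :=
  ⟨locallyIntegrableOn_zero, locallyIntegrableOn_zero, fun φ _ _ _ => by simp⟩

lemma HasWeakDerivOn.congr (hI : IsOpen I) (h : HasWeakDerivOn I u v)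
    (hu : u =ᵐ[volume.restrict I] u₁) (hv : v =ᵐ[volume.restrict I] v₁) :
    HasWeakDerivOn I u₁ v₁ := by
  have key : ∀ {f g : ℝ → ℂ}, f =ᵐ[volume.restrict I] g → LocallyIntegrableOn f I volume →
      LocallyIntegrableOn g I volume := by
    intro f g hfg hf
    rw [locallyIntegrableOn_iff hI.isLocallyClosed] at hf ⊢
    intro k hk hkc
    exact (hf k hk hkc).congr (ae_mono (Measure.restrict_mono hk le_rfl) hfg)
  refine ⟨key hu h.1, key hv h.2.1, fun φ hφ hc hs => ?_⟩
  rw [integral_congr_ae (g := fun x => deriv φ x • u x) (hu.mono fun x hx => by simp [hx]),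
    integral_congr_ae (f := fun x => φ x • v₁ x) (g := fun x => φ x • v x)
      (hv.mono fun x hx => by simp [hx])]
  exact h.2.2 φ hφ hc hs

lemma HasWeakDerivOn.unique (hI : IsOpen I) (h₁ : HasWeakDerivOn I u₁ v₁)
    (h₂ : HasWeakDerivOn I u₂ v₂) (hu : u₁ =ᵐ[volume.restrict I] u₂) :
    v₁ =ᵐ[volume.restrict I] v₂ := by
  have h := (h₁.congr hI hu (ae_eq_refl _)).add hI (h₂.smul (-1))
  have h0 : ∀ᵐ x ∂volume, x ∈ I → (v₁ + (-1 : ℂ) • v₂) x = 0 := by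
    refine hI.ae_eq_zero_of_integral_contDiff_smul_eq_zero h.2.1 fun φ hφ hc hs => ?_
    have e := h.2.2 φ hφ hc hs
    rw [← setIntegral_eq_integral_of_forall_compl_eq_zero (s := I), ← neg_eq_zero, ← e]
    · simp
    · intro x hx
      have : φ x = 0 := by
        by_contra hne
        exact hx (hs (subset_tsupport φ hne))
      simp [this]
  rw [EventuallyEq, ae_restrict_iff' hI.measurableSet]
  filter_upwards [h0] with x hx hxI
  have := hx hxI
  simp only [Pi.add_apply, Pi.smul_apply, smul_eq_mul] at this
  linear_combination this

lemma MemH2.zero : MemH2 I 0 :=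
  ⟨MemLp.zero, 0, 0, MemLp.zero, MemLp.zero, .zero, .zero⟩

lemma MemH2.add (hI : IsOpen I) (h₁ : MemH2 I u₁) (h₂ : MemH2 I u₂) : MemH2 I (u₁ + u₂) := by
  obtain ⟨a, p, q, hp, hq, hup, hpq⟩ := h₁
  obtain ⟨a', p', q', hp', hq', hup', hpq'⟩ := h₂
  exact ⟨a.add a', p + p', q + q', hp.add hp', hq.add hq', hup.add hI hup', hpq.add hI hpq'⟩

lemma MemH2.smul (c : ℂ) (h : MemH2 I u) : MemH2 I (c • u) := by
  obtain ⟨a, p, q, hp, hq, hup, hpq⟩ := h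
  exact ⟨a.const_smul c, c • p, c • q, hp.const_smul c, hq.const_smul c, hup.smul c, hpq.smul c⟩

end WeakDeriv

/-- The space `𝒲(ℝ)` of continuous functions on `ℝ` whose restrictions to the two open
half-lines are of class `H²`. -/
def W : Submodule ℂ (ℝ → ℂ) where
  carrier := {u | Continuous u ∧ MemH2 (Iio 0) u ∧ MemH2 (Ioi 0) u}
  zero_mem' := ⟨continuous_zero, .zero, .zero⟩
  add_mem' h₁ h₂ := ⟨h₁.1.add h₂.1, h₁.2.1.add isOpen_Iio h₂.2.1, h₁.2.2.add isOpen_Ioi h₂.2.2⟩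
  smul_mem' c _ h := ⟨h.1.const_smul c, h.2.1.smul c, h.2.2.smul c⟩

lemma ae_ne_zero : ∀ᵐ x : ℝ ∂volume, x ≠ 0 := by
  simp [ae_iff]

lemma ae_eq_of_halves {f g : ℝ → ℂ} (h₁ : f =ᵐ[volume.restrict (Iio 0)] g)
    (h₂ : f =ᵐ[volume.restrict (Ioi 0)] g) : f =ᵐ[volume] g := by
  rw [EventuallyEq, ae_restrict_iff' measurableSet_Iio] at h₁
  rw [EventuallyEq, ae_restrict_iff' measurableSet_Ioi] at h₂
  filter_upwards [h₁, h₂, ae_ne_zero] with x h1 h2 h0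
  rcases lt_or_gt_of_ne h0 with h | h
  · exact h1 h
  · exact h2 h

lemma memLp_glue {f g : ℝ → ℂ} (hf : MemLp f 2 (volume.restrict (Iio 0)))
    (hg : MemLp g 2 (volume.restrict (Ioi 0))) :
    MemLp ((Iio 0).indicator f + (Ioi 0).indicator g) 2 (volume : Measure ℝ) :=
  ((memLp_indicator_iff_restrict measurableSet_Iio).2 hf).add
    ((memLp_indicator_iff_restrict measurableSet_Ioi).2 hg)

lemma glue_left (f g : ℝ → ℂ) :
    (Iio 0).indicator f + (Ioi 0).indicator g =ᵐ[volume.restrict (Iio 0)] f := by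
  rw [EventuallyEq, ae_restrict_iff' measurableSet_Iio]
  refine Eventually.of_forall fun x hx => ?_
  have : ¬ (0 < x) := not_lt.2 (le_of_lt hx)
  simp_all

lemma glue_right (f g : ℝ → ℂ) :
    (Iio 0).indicator f + (Ioi 0).indicator g =ᵐ[volume.restrict (Ioi 0)] g := by
  rw [EventuallyEq, ae_restrict_iff' measurableSet_Ioi]
  refine Eventually.of_forall fun x hx => ?_
  have : ¬ (x < 0) := not_lt.2 (le_of_lt hx)
  simp_all

lemma W.memLp (u : W) : MemLp (u : ℝ → ℂ) 2 (volume : Measure ℝ) :=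
  (memLp_glue u.2.2.1.1 u.2.2.2.1).ae_eq (ae_eq_of_halves (glue_left _ _) (glue_right _ _))

/-- The class in `L²(ℝ)` of a function from `𝒲(ℝ)`. -/
def W.toL2 : W →ₗ[ℂ] Lp ℂ 2 (volume : Measure ℝ) where
  toFun u := (W.memLp u).toLp u
  map_add' u v := MemLp.toLp_add (W.memLp u) (W.memLp v)
  map_smul' c u := MemLp.toLp_const_smul c (W.memLp u)

lemma W.toL2_injective : Function.Injective W.toL2 := by
  intro u v h
  have h' : (u : ℝ → ℂ) =ᵐ[volume] v := (MemLp.toLp_eq_toLp_iff (W.memLp u) (W.memLp v)).1 h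
  exact Subtype.ext (Continuous.ae_eq_iff_eq volume u.2.1 v.2.1 |>.1 h')

lemma W.exists_isSecondDeriv (u : W) : ∃ f, IsSecondDeriv u f := by
  obtain ⟨-, ⟨-, p, q, -, hq, hup, hpq⟩, ⟨-, p', q', -, hq', hup', hpq'⟩⟩ := u.2
  have hf := (memLp_glue hq hq').coeFn_toLp
  refine ⟨(memLp_glue hq hq').toLp _, ⟨p, hup, hpq.congr isOpen_Iio (ae_eq_refl _) ?_⟩,
    ⟨p', hup', hpq'.congr isOpen_Ioi (ae_eq_refl _) ?_⟩⟩
  · exact (EventuallyEq.trans (ae_restrict_of_ae hf) (glue_left _ _)).symm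
  · exact (EventuallyEq.trans (ae_restrict_of_ae hf) (glue_right _ _)).symm

lemma IsSecondDeriv.unique {u : ℝ → ℂ} {f g : Lp ℂ 2 (volume : Measure ℝ)}
    (hf : IsSecondDeriv u f) (hg : IsSecondDeriv u g) : f = g := by
  obtain ⟨⟨p, hp, hpf⟩, ⟨p', hp', hpf'⟩⟩ := hf
  obtain ⟨⟨q, hq, hqg⟩, ⟨q', hq', hqg'⟩⟩ := hg
  refine Lp.ext (ae_eq_of_halves ?_ ?_)
  · exact hpf.unique isOpen_Iio hqg (hp.unique isOpen_Iio hq (ae_eq_refl _))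
  · exact hpf'.unique isOpen_Ioi hqg' (hp'.unique isOpen_Ioi hq' (ae_eq_refl _))

lemma IsSecondDeriv.add {u v : ℝ → ℂ} {f g : Lp ℂ 2 (volume : Measure ℝ)}
    (hf : IsSecondDeriv u f) (hg : IsSecondDeriv v g) : IsSecondDeriv (u + v) (f + g) := by
  obtain ⟨⟨p, hp, hpf⟩, ⟨p', hp', hpf'⟩⟩ := hf
  obtain ⟨⟨q, hq, hqg⟩, ⟨q', hq', hqg'⟩⟩ := hg
  have e := (Lp.coeFn_add f g).symm
  exact ⟨⟨_, hp.add isOpen_Iio hq, (hpf.add isOpen_Iio hqg).congr isOpen_Iio (ae_eq_refl _)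
      (ae_restrict_of_ae e)⟩,
    ⟨_, hp'.add isOpen_Ioi hq', (hpf'.add isOpen_Ioi hqg').congr isOpen_Ioi (ae_eq_refl _)
      (ae_restrict_of_ae e)⟩⟩

lemma IsSecondDeriv.smul {u : ℝ → ℂ} {f : Lp ℂ 2 (volume : Measure ℝ)} (c : ℂ)
    (hf : IsSecondDeriv u f) : IsSecondDeriv (c • u) (c • f) := by
  obtain ⟨⟨p, hp, hpf⟩, ⟨p', hp', hpf'⟩⟩ := hf
  have e := (Lp.coeFn_smul c f).symm
  exact ⟨⟨_, hp.smul c, (hpf.smul c).congr isOpen_Iio (ae_eq_refl _) (ae_restrict_of_ae e)⟩,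
    ⟨_, hp'.smul c, (hpf'.smul c).congr isOpen_Ioi (ae_eq_refl _) (ae_restrict_of_ae e)⟩⟩

/-- The second derivative away from `0` of a function from `𝒲(ℝ)`, as an element of `L²(ℝ)`. -/
def W.secondDeriv : W →ₗ[ℂ] Lp ℂ 2 (volume : Measure ℝ) where
  toFun u := (W.exists_isSecondDeriv u).choose
  map_add' u v := (W.exists_isSecondDeriv (u + v)).choose_spec.unique
    ((W.exists_isSecondDeriv u).choose_spec.add (W.exists_isSecondDeriv v).choose_spec)
  map_smul' c u := (W.exists_isSecondDeriv (c • u)).choose_spec.unique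
    ((W.exists_isSecondDeriv u).choose_spec.smul c)

lemma W.isSecondDeriv (u : W) : IsSecondDeriv u (W.secondDeriv u) :=
  (W.exists_isSecondDeriv u).choose_spec

/-- The differential expression `L u = -u'' + u / 2`, `x ≠ 0`. -/
def L : W →ₗ[ℂ] Lp ℂ 2 (volume : Measure ℝ) :=
  -W.secondDeriv + (1 / 2 : ℂ) • W.toL2

/-- The differential expression `(L + n) u`. -/
def Lshift (n : ℕ) : W →ₗ[ℂ] Lp ℂ 2 (volume : Measure ℝ) :=
  L + (n : ℂ) • W.toL2

/-- The matching conditions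
`μ (uₙ'(0+) - uₙ'(0-)) = √(n+1) uₙ₊₁(0) + √n uₙ₋₁(0)`, `n = 0, 1, 2, …`
(for `n = 0` the last term vanishes because of the factor `√0`). -/
def Matching (μ : ℝ) (u : ℕ → W) : Prop :=
  ∀ n : ℕ, ∃ a b : ℂ, HasDerivRight (u n) a ∧ HasDerivLeft (u n) b ∧
    (μ : ℂ) * (a - b) =
      (Real.sqrt (n + 1) : ℂ) * (u (n + 1) : ℝ → ℂ) 0 +
        (Real.sqrt n : ℂ) * (u (n - 1) : ℝ → ℂ) 0

lemma Matching.zero (μ : ℝ) : Matching μ 0 := fun n =>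
  ⟨0, 0, ⟨0, HasWeakDerivOn.zero, tendsto_const_nhds⟩,
    ⟨0, HasWeakDerivOn.zero, tendsto_const_nhds⟩, by simp⟩

lemma Matching.add {μ : ℝ} {u v : ℕ → W} (hu : Matching μ u) (hv : Matching μ v) :
    Matching μ (u + v) := fun n => by
  obtain ⟨a, b, ⟨p, hp, ha⟩, ⟨q, hq, hb⟩, e⟩ := hu n
  obtain ⟨a', b', ⟨p', hp', ha'⟩, ⟨q', hq', hb'⟩, e'⟩ := hv n
  refine ⟨a + a', b + b', ⟨_, hp.add isOpen_Ioi hp', ha.add ha'⟩,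
    ⟨_, hq.add isOpen_Iio hq', hb.add hb'⟩, ?_⟩
  simp only [Pi.add_apply, Submodule.coe_add]
  linear_combination e + e'

lemma Matching.smul {μ : ℝ} {u : ℕ → W} (c : ℂ) (hu : Matching μ u) :
    Matching μ (c • u) := fun n => by
  obtain ⟨a, b, ⟨p, hp, ha⟩, ⟨q, hq, hb⟩, e⟩ := hu n
  refine ⟨c * a, c * b, ⟨_, hp.smul c, ha.const_smul c⟩, ⟨_, hq.smul c, hb.const_smul c⟩, ?_⟩
  simp only [Pi.smul_apply, Submodule.coe_smul, smul_eq_mul]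
  linear_combination c * e

/-- The Hilbert space `ℓ²(ℕ₀, L²(ℝ))`. -/
abbrev H : Type := lp (fun _ : ℕ => Lp ℂ 2 (volume : Measure ℝ)) 2

/-- The domain `𝒟_α`: the elements `U ∼ {uₙ}` with `uₙ ∈ 𝒲(ℝ)` for all `n` that satisfy the
matching conditions with `μ = √2 / α` and the condition `∑ₙ ‖(L + n) uₙ‖² < ∞`. -/
def dom (α : ℝ) : Submodule ℂ H where
  carrier := {U | ∃ u : ℕ → W, (∀ n, U n = W.toL2 (u n)) ∧ Matching (Real.sqrt 2 / α) u ∧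
    Summable fun n => ‖Lshift n (u n)‖ ^ 2}
  zero_mem' := ⟨0, fun n => by simp, .zero _, by simp⟩
  add_mem' := by
    rintro U V ⟨u, hu, mu, su⟩ ⟨v, hv, mv, sv⟩
    refine ⟨u + v, fun n => by simp [hu, hv], mu.add mv, ?_⟩
    refine Summable.of_nonneg_of_le (fun n => by positivity) (fun n => ?_)
      ((su.add sv).mul_left 2)
    have h := norm_add_le (Lshift n (u n)) (Lshift n (v n))
    simp only [Pi.add_apply, map_add]
    nlinarith [sq_nonneg (‖Lshift n (u n)‖ - ‖Lshift n (v n)‖),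
      norm_nonneg (Lshift n (u n) + Lshift n (v n)),
      norm_nonneg (Lshift n (u n)), norm_nonneg (Lshift n (v n))]
  smul_mem' := by
    rintro c U ⟨u, hu, mu, su⟩
    refine ⟨c • u, fun n => by simp [hu], mu.smul c, ?_⟩
    simpa [norm_smul, mul_pow] using su.mul_left (‖c‖ ^ 2)

/-- The components `uₙ ∈ 𝒲(ℝ)` of an element of `𝒟_α`. -/
def comp {α : ℝ} (U : dom α) : ℕ → W := U.2.choose

lemma comp_spec {α : ℝ} (U : dom α) (n : ℕ) : (U : H) n = W.toL2 (comp U n) :=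
  U.2.choose_spec.1 n

lemma comp_matching {α : ℝ} (U : dom α) : Matching (Real.sqrt 2 / α) (comp U) :=
  U.2.choose_spec.2.1

lemma comp_summable {α : ℝ} (U : dom α) : Summable fun n => ‖Lshift n (comp U n)‖ ^ 2 :=
  U.2.choose_spec.2.2

/-- The operator `A_α U ∼ {(L + n) uₙ}` with domain `𝒟_α`. -/
def A (α : ℝ) : H →ₗ.[ℂ] H where
  domain := dom α
  toFun :=
    { toFun := fun U => ⟨fun n => Lshift n (comp U n),
        memℓp_gen (by simpa using comp_summable U)⟩
      map_add' := fun U V => by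
        ext1
        funext n
        have : comp (U + V) n = comp U n + comp V n := W.toL2_injective (by
          rw [map_add, ← comp_spec, ← comp_spec, ← comp_spec]; rfl)
        simp only [this, map_add]
        rfl
      map_smul' := fun c U => by
        ext1
        funext n
        have : comp (c • U) n = c • comp U n := W.toL2_injective (by
          rw [map_smul, ← comp_spec, ← comp_spec]; rfl)
        simp [this] }

lemma A_apply {α : ℝ} (U : (A α).domain) (u : ℕ → W) (hu : ∀ n, (U : H) n = W.toL2 (u n))
    (n : ℕ) : (A α U : H) n = Lshift n (u n) := by
  have h : comp (α := α) U n = u n :=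
    W.toL2_injective ((comp_spec (α := α) U n).symm.trans (hu n))
  exact congrArg (Lshift n) h

/-- The elements of `ℓ²(ℕ₀, L²(ℝ))` with only finitely many non-zero components. -/
def finSupp : Submodule ℂ H where
  carrier := {U | {n | U n ≠ 0}.Finite}
  zero_mem' := by simp
  add_mem' := by
    intro U V hU hV
    refine (hU.union hV).subset fun n hn => ?_
    by_contra h
    simp only [mem_union, mem_ofPred_eq, not_or, not_not] at h
    exact hn (by simp [h.1, h.2])
  smul_mem' := by
    intro c U hU
    refine hU.subset fun n hn h => hn (by simp [h])

/-- The operator `A_α⁰`: the restriction of `A_α` to the elements of `𝒟_α` with only finitely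
many non-zero components. -/
def A0 (α : ℝ) : H →ₗ.[ℂ] H := (A α).domRestrict finSupp

end Smilansky

end

noncomputable section

namespace Smilansky

open MeasureTheory Set Filter Topology
open scoped ContDiff ENNReal ComplexConjugate

/-! Two facts carry the theorem: `A α` is symmetric, and every adjoint pair of `A0 α` already
belongs to the graph of `A α`.

Symmetry. Green's formula turns the defect of `L + n` on each component into a form in the value and
the derivative jump at `0` (`inner_Lshift_sub`). The matching conditions make the jumps a Jacobi
matrix applied to the values, so partial sums of the defect telescope to a discrete Wronskian at `N`
(`sum_jacobi_sub`). The trace estimate `norm_apply_zero_sq_le` bounds it by `N` times the term of a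
summable series. Since the Wronskian also converges, a non-zero limit would make the harmonic series
converge (`eq_zero_of_tendsto_of_summable`). The size of `α` plays no role.

Maximality (`mem_dom_of_weak`). Suppose `⟪F, U⟫ = ⟪V, A0 U⟫` for all finite `U`. Testing on a single
component with zero value and zero jump shows that `V n` differs from a solution of `(L + n) r = F
n` by a multiple of `exp (-√(n + 1/2) |x|)`; hence `V n` comes from `𝒲(ℝ)` and `(L + n)` maps it to
`F n`. Testing on finite sequences with prescribed values at `0` then forces the matching
conditions.

With `V = 0` maximality gives density; with symmetry it gives `A ⊆ A* ⊆ A0* ⊆ A`, and an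
orthogonality argument in `H × H` identifies the closure of `A0`. -/

/-! ### Integration by parts and weak derivatives of indefinite integrals -/

lemma integral_mul_primitive_add {a b : ℝ} (hab : a ≤ b) {f g : ℝ → ℂ}
    (hf : IntervalIntegrable f volume a b) (hg : IntervalIntegrable g volume a b) :
    (∫ x in a..b, f x * ∫ y in a..x, g y) + (∫ x in a..b, g x * ∫ y in a..x, f y) =
      (∫ x in a..b, f x) * ∫ x in a..b, g x := by
  rw [intervalIntegrable_iff_integrableOn_Ioc_of_le hab] at hf hg
  set m : Measure ℝ := volume.restrict (Ioc a b) with hm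
  have hfg : Integrable (fun z : ℝ × ℝ => f z.1 * g z.2) (m.prod m) := hf.mul_prod hg
  have hS : MeasurableSet {z : ℝ × ℝ | z.2 ≤ z.1} := measurableSet_le measurable_snd measurable_fst
  have hT : MeasurableSet {z : ℝ × ℝ | z.1 ≤ z.2} := measurableSet_le measurable_fst measurable_snd
  have inner : ∀ (h : ℝ → ℂ) (x : ℝ), x ∈ Ioc a b →
      ∫ y in a..x, h y = ∫ y, (Iic x).indicator h y ∂m := by
    intro h x hx
    rw [intervalIntegral.integral_of_le hx.1.le, integral_indicator measurableSet_Iic, hm,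
      Measure.restrict_restrict measurableSet_Iic]
    congr 2
    ext y
    simp only [mem_Ioc, mem_inter_iff, mem_Iic]
    exact ⟨fun h => ⟨h.2, h.1, h.2.trans hx.2⟩, fun h => ⟨h.2.1, h.1⟩⟩
  have e1 : (∫ x in a..b, f x * ∫ y in a..x, g y) =
      ∫ z, {z : ℝ × ℝ | z.2 ≤ z.1}.indicator (fun z => f z.1 * g z.2) z ∂(m.prod m) := by
    rw [integral_prod _ (hfg.indicator hS), intervalIntegral.integral_of_le hab]
    refine setIntegral_congr_fun measurableSet_Ioc fun x hx => ?_
    simp only [inner g x hx, ← integral_const_mul]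
    refine integral_congr_ae (Eventually.of_forall fun y => ?_)
    by_cases h : y ≤ x <;> simp [h]
  have e2 : (∫ x in a..b, g x * ∫ y in a..x, f y) =
      ∫ z, {z : ℝ × ℝ | z.1 ≤ z.2}.indicator (fun z => f z.1 * g z.2) z ∂(m.prod m) := by
    rw [integral_prod_symm _ (hfg.indicator hT), intervalIntegral.integral_of_le hab]
    refine setIntegral_congr_fun measurableSet_Ioc fun x hx => ?_
    simp only [inner f x hx, ← integral_const_mul]
    refine integral_congr_ae (Eventually.of_forall fun y => ?_)
    by_cases h : y ≤ x <;> simp [h, mul_comm]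
  -- The two iterated integrals run over the triangles below and above the diagonal; these overlap
  -- in a null set, so together they give the integral over the square.
  have hdiag : ∀ᵐ z ∂(m.prod m), z.1 ≠ z.2 := by
    rw [Measure.ae_prod_iff_ae_ae (p := fun z : ℝ × ℝ => z.1 ≠ z.2)
      (measurableSet_eq_fun measurable_fst measurable_snd).compl]
    refine Eventually.of_forall fun x => ?_
    have : ∀ᵐ y ∂m, y ≠ x := ae_restrict_of_ae (by simp [ae_iff])
    filter_upwards [this] with y hy using hy.symm
  rw [e1, e2, ← integral_add (hfg.indicator hS) (hfg.indicator hT),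
    intervalIntegral.integral_of_le hab, intervalIntegral.integral_of_le hab,
    ← integral_prod_mul]
  refine integral_congr_ae (hdiag.mono fun z hz => ?_)
  rcases lt_or_gt_of_ne hz with h | h
  · simp [h.le, h.not_ge]
  · simp [h.le, h.not_ge]

/-- Integration by parts for two functions given as indefinite integrals. -/
lemma integral_mul_add_mul_of_primitive {a b : ℝ} (hab : a ≤ b) {F G f g : ℝ → ℂ}
    (hf : IntervalIntegrable f volume a b) (hg : IntervalIntegrable g volume a b)
    (hF : ∀ x ∈ Icc a b, F x = F a + ∫ y in a..x, f y)
    (hG : ∀ x ∈ Icc a b, G x = G a + ∫ y in a..x, g y) :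
    ∫ x in a..b, (f x * G x + F x * g x) = F b * G b - F a * G a := by
  have cont : ∀ {h : ℝ → ℂ}, IntervalIntegrable h volume a b →
      ContinuousOn (fun x => ∫ y in a..x, h y) (uIcc a b) := fun hh =>
    intervalIntegral.continuousOn_primitive_interval'  hh left_mem_uIcc
  have i1 : IntervalIntegrable (fun x => f x * ∫ y in a..x, g y) volume a b :=
    hf.mul_continuousOn (cont hg)
  have i2 : IntervalIntegrable (fun x => g x * ∫ y in a..x, f y) volume a b :=
    hg.mul_continuousOn (cont hf)
  have e : ∫ x in a..b, (f x * G x + F x * g x) =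
      ∫ x in a..b, ((f x * ∫ y in a..x, g y) + (g x * ∫ y in a..x, f y)) +
        (f x * G a + F a * g x) := by
    refine intervalIntegral.integral_congr fun x hx => ?_
    rw [uIcc_of_le hab] at hx
    simp only [hF x hx, hG x hx]
    ring
  rw [e, intervalIntegral.integral_add (i1.add i2) ((hf.mul_const _).add (hg.const_mul _)),
    intervalIntegral.integral_add i1 i2,
    intervalIntegral.integral_add (hf.mul_const _) (hg.const_mul _),
    integral_mul_primitive_add hab hf hg, hF b (right_mem_Icc.2 hab), hG b (right_mem_Icc.2 hab),
    intervalIntegral.integral_mul_const, intervalIntegral.integral_const_mul]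
  ring

lemma continuous_of_primitive {F f : ℝ → ℂ} (hf : LocallyIntegrable f volume)
    (hF : ∀ x y, F y - F x = ∫ t in x..y, f t) : Continuous F := by
  have : F = fun x => F 0 + ∫ t in (0 : ℝ)..x, f t := by
    funext x; rw [← hF 0 x]; ring
  rw [this]
  exact continuous_const.add (intervalIntegral.continuous_primitive
    (fun a b => (hf.integrableOn_isCompact isCompact_uIcc).intervalIntegrable) 0)

/-- An indefinite integral is weakly differentiable. -/
lemma HasWeakDerivOn.of_primitive {I : Set ℝ} {F f : ℝ → ℂ}
    (hf : LocallyIntegrable f volume) (hF : ∀ x y, F y - F x = ∫ t in x..y, f t) :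
    HasWeakDerivOn I F f := by
  have hii : ∀ a b, IntervalIntegrable f volume a b := fun a b =>
    (hf.integrableOn_isCompact isCompact_uIcc).intervalIntegrable
  have hFc : Continuous F := continuous_of_primitive hf hF
  refine ⟨hFc.locallyIntegrable.locallyIntegrableOn I, hf.locallyIntegrableOn I,
    fun φ hφ hc hs => ?_⟩
  obtain ⟨R, hR⟩ := hc.isCompact.isBounded.subset_ball 0
  have hsupp : tsupport φ ⊆ Ioo (-R) R := by simpa [Real.ball_eq_Ioo] using hR
  -- The radius obtained from boundedness may be negative, but then the support is empty.
  have hR0 : -R ≤ R ∨ φ = 0 := by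
    by_cases h : -R ≤ R
    · exact .inl h
    · right
      rw [← tsupport_eq_empty_iff, ← subset_empty_iff]
      refine hsupp.trans ?_
      simp [Ioo_eq_empty_of_le (not_le.1 h).le]
  rcases hR0 with hR0 | rfl
  swap
  · simp
  have z : ∀ x, x ∉ Ioo (-R) R → φ x = 0 := fun x hx => by
    by_contra h
    exact hx (hsupp (subset_tsupport φ h))
  have key := integral_mul_add_mul_of_primitive hR0 (F := fun x => (φ x : ℂ)) (G := F)
    (f := fun x => ((deriv φ x : ℝ) : ℂ)) (g := f)
    ((Complex.continuous_ofReal.comp (hφ.continuous_deriv (by simp))).intervalIntegrable _ _)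
    (hii _ _) (fun x _ => by
      rw [intervalIntegral.integral_ofReal, intervalIntegral.integral_deriv_eq_sub']
      · push_cast; ring
      · rfl
      · exact fun x _ => (hφ.differentiable (by simp)) x
      · exact (hφ.continuous_deriv (by simp)).continuousOn)
    (fun x _ => by rw [← hF]; ring)
  rw [z R (by simp), z (-R) (by simp)] at key
  have out : ∀ h : ℝ → ℂ, (∀ x, x ∉ tsupport φ → h x = 0) →
      ∫ x in I, h x = ∫ x in (-R)..R, h x := by
    intro h hh
    rw [setIntegral_eq_integral_of_forall_compl_eq_zero fun x hx => hh x fun hx' => hx (hs hx'),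
      intervalIntegral.integral_of_le hR0,
      setIntegral_eq_integral_of_forall_compl_eq_zero fun x hx => hh x fun hx' =>
        hx (Ioo_subset_Ioc_self (hsupp hx'))]
  rw [out _ fun x hx => by
      rw [Function.notMem_support.1 fun h => hx (support_deriv_subset h), zero_smul],
    out _ fun x hx => by rw [image_eq_zero_of_notMem_tsupport hx, zero_smul],
    ← sub_eq_zero, sub_neg_eq_add, ← intervalIntegral.integral_add]
  · simpa using key
  · exact (((hφ.continuous_deriv (by simp)).smul hFc).intervalIntegrable _ _)
  · exact (hii _ _).continuousOn_smul hφ.continuous.continuousOn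

/-! ### Weakly differentiable functions on the half-line as indefinite integrals -/

/-- A test function on `(0, ∞)` with vanishing integral is the derivative of a test function. -/
lemma exists_testFunction_deriv_eq {h : ℝ → ℝ} (hh : ContDiff ℝ ∞ h) (hc : HasCompactSupport h)
    (hs : tsupport h ⊆ Ioi 0) (h0 : ∫ x, h x = 0) :
    ∃ φ : ℝ → ℝ, ContDiff ℝ ∞ φ ∧ HasCompactSupport φ ∧ tsupport φ ⊆ Ioi 0 ∧ deriv φ = h := by
  -- The point `1` only ensures that a minimum and a maximum exist when `h = 0`.
  have hK : IsCompact (tsupport h ∪ {1}) := hc.isCompact.union isCompact_singleton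
  have hne : (tsupport h ∪ {1}).Nonempty := ⟨1, by simp⟩
  obtain ⟨m, hm, hmin⟩ := hK.exists_isLeast hne
  obtain ⟨M, hM, hmax⟩ := hK.exists_isGreatest hne
  have hm0 : 0 < m := by
    rcases hm with hm | hm
    · exact hs hm
    · rw [mem_singleton_iff.1 hm]; norm_num
  have hmM : m ≤ M := hmin hM
  have z : ∀ x, x ∉ Icc m M → h x = 0 := fun x hx =>
    image_eq_zero_of_notMem_tsupport fun h => hx ⟨hmin (.inl h), hmax (.inl h)⟩
  let φ : ℝ → ℝ := fun x => ∫ y in (0 : ℝ)..x, h y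
  have hd : ∀ x, HasDerivAt φ (h x) x := fun x =>
    intervalIntegral.integral_hasDerivAt_right (hh.continuous.intervalIntegrable _ _)
      (hh.continuous.stronglyMeasurableAtFilter _ _) hh.continuous.continuousAt
  have hd' : deriv φ = h := funext fun x => (hd x).deriv
  have hφs : tsupport φ ⊆ Icc m M := by
    refine closure_minimal (fun x hx => ?_) isClosed_Icc
    by_contra hxn
    refine hx ?_
    rcases lt_or_ge x m with hxm | hxm
    · refine (intervalIntegral.integral_congr (g := fun _ => 0) fun y hy => ?_).trans (by simp)
      refine z y fun hy' => ?_
      rcases mem_uIcc.1 hy with h | h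
      · exact absurd (hy'.1.trans h.2) (not_le.2 hxm)
      · exact absurd (hy'.1.trans h.2) (not_le.2 hm0)
    · have hxM : M < x := by
        by_contra h
        exact hxn ⟨hxm, not_lt.1 h⟩
      change ∫ y in (0 : ℝ)..x, h y = 0
      rw [intervalIntegral.integral_of_le (hm0.le.trans hxm),
        setIntegral_eq_integral_of_forall_compl_eq_zero, h0]
      intro y hy
      exact z y fun hy' => hy ⟨hm0.trans_le hy'.1, hy'.2.trans hxM.le⟩
  refine ⟨φ, ?_, HasCompactSupport.of_support_subset_isCompact isCompact_Icc
    ((subset_tsupport φ).trans hφs), hφs.trans fun x hx => hm0.trans_le hx.1, hd'⟩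
  rw [contDiff_infty_iff_deriv, hd']
  exact ⟨fun x => (hd x).differentiableAt, hh⟩

/-- The lemma of du Bois-Reymond on the half-line. -/
lemma HasWeakDerivOn.exists_ae_eq_const {u : ℝ → ℂ} (hu : HasWeakDerivOn (Ioi 0) u 0) :
    ∃ c : ℂ, u =ᵐ[volume.restrict (Ioi 0)] fun _ => c := by
  -- A fixed bump in `[1/2, 3/2]` of mass `1`: for a test function `g` with integral `t`, `g - t ψ`
  -- has mean zero, hence is the derivative of a test function, so `∫ g u = t ∫ ψ u`. This makes `c
  -- = ∫ ψ u` the constant.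
  let β : ContDiffBump (1 : ℝ) := ⟨1 / 4, 1 / 2, by norm_num, by norm_num⟩
  let ψ : ℝ → ℝ := β.normed volume
  have hψ : ContDiff ℝ ∞ ψ := β.contDiff_normed
  have hψc : HasCompactSupport ψ := β.hasCompactSupport_normed
  have hψs : tsupport ψ ⊆ Ioi 0 := by
    change tsupport (β.normed volume) ⊆ _
    rw [β.tsupport_normed_eq, Real.closedBall_eq_Icc]
    intro x hx
    have := hx.1
    simp only [β] at this
    exact lt_of_lt_of_le (by norm_num) this
  have hψ1 : ∫ x, ψ x = 1 := β.integral_normed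
  set c : ℂ := ∫ x in Ioi (0 : ℝ), ψ x • u x with hcdef
  have ez : ∀ {g : ℝ → ℝ} {w : ℝ → ℂ}, tsupport g ⊆ Ioi 0 →
      ∫ x in Ioi (0 : ℝ), g x • w x = ∫ x, g x • w x := fun hs =>
    setIntegral_eq_integral_of_forall_compl_eq_zero fun x hx => by
      rw [image_eq_zero_of_notMem_tsupport fun h => hx (hs h), zero_smul]
  have hloc : LocallyIntegrableOn (fun x => u x - c) (Ioi 0) volume :=
    hu.1.sub ((locallyIntegrable_const c).locallyIntegrableOn _)
  have hz : ∀ᵐ x ∂volume, x ∈ Ioi (0 : ℝ) → u x - c = 0 := by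
    refine isOpen_Ioi.ae_eq_zero_of_integral_contDiff_smul_eq_zero hloc fun g hg hgc hgs => ?_
    have hgi : Integrable g := hg.continuous.integrable_of_hasCompactSupport hgc
    have hψi : Integrable ψ := hψ.continuous.integrable_of_hasCompactSupport hψc
    set t : ℝ := ∫ x, g x
    have hsub : tsupport (fun x => g x - t * ψ x) ⊆ Ioi 0 := by
      refine (tsupport_sub g fun x => t * ψ x).trans (union_subset hgs ?_)
      exact (tsupport_mul_subset_right (f := fun _ => t)).trans hψs
    obtain ⟨φ, h1, h2, h3, h4⟩ := exists_testFunction_deriv_eq (h := fun x => g x - t * ψ x)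
      (hg.sub (contDiff_const.mul hψ)) (hgc.sub hψc.mul_left) hsub (by
        rw [integral_sub hgi (hψi.const_mul t), integral_const_mul, hψ1]; simp [t])
    have e := hu.2.2 φ h1 h2 h3
    rw [h4] at e
    have i1 : IntegrableOn (fun x => g x • u x) (Ioi 0) volume :=
      integrableOn_smul isOpen_Ioi hu.1 hg.continuous hgc hgs
    have i2 : IntegrableOn (fun x => ψ x • u x) (Ioi 0) volume :=
      integrableOn_smul isOpen_Ioi hu.1 hψ.continuous hψc hψs
    have i2' : IntegrableOn (fun x => t • ψ x • u x) (Ioi 0) volume := i2.smul t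
    have i3 : IntegrableOn (fun x => g x • c) (Ioi 0) volume := hgi.integrableOn.smul_const c
    simp only [sub_smul, mul_smul, Pi.zero_apply, smul_zero, integral_zero, neg_zero] at e
    rw [integral_sub i1 i2', integral_smul, ← hcdef] at e
    rw [← ez hgs]
    simp only [smul_sub]
    rw [integral_sub i1 i3, ez (w := fun _ => c) hgs, integral_smul_const]
    exact e
  refine ⟨c, ?_⟩
  rw [EventuallyEq, ae_restrict_iff' measurableSet_Ioi]
  filter_upwards [hz] with x hx hxI using sub_eq_zero.1 (hx hxI)

/-- Extension by zero allows indefinite integrals starting at `0` to be treated as functions on the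
whole line; integrability up to the endpoint is what makes this possible. -/
lemma locallyIntegrable_indicator_Ioi {v : ℝ → ℂ}
    (hv : ∀ R, IntegrableOn v (Ioc 0 R) volume) :
    LocallyIntegrable ((Ioi 0).indicator v) volume := by
  rw [locallyIntegrable_iff]
  intro K hK
  obtain ⟨R, hR⟩ := hK.bddAbove
  have : IntegrableOn ((Ioi 0).indicator v) (Iic R) volume := by
    rw [IntegrableOn, integrable_indicator_iff measurableSet_Ioi, IntegrableOn,
      Measure.restrict_restrict measurableSet_Ioi, Ioi_inter_Iic]
    exact hv R
  exact this.mono_set fun x hx => hR hx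

/-- A weakly differentiable function on `(0, ∞)` whose weak derivative is integrable near `0` is
an indefinite integral. -/
lemma HasWeakDerivOn.exists_ae_eq_primitive {u v : ℝ → ℂ} (h : HasWeakDerivOn (Ioi 0) u v)
    (hv : ∀ R, IntegrableOn v (Ioc 0 R) volume) :
    ∃ c : ℂ, u =ᵐ[volume.restrict (Ioi 0)] fun x => c + ∫ t in (0 : ℝ)..x, v t := by
  have hl := locallyIntegrable_indicator_Ioi hv
  set w := (Ioi (0 : ℝ)).indicator v with hw
  have hii : ∀ a b, IntervalIntegrable w volume a b := fun a b =>
    (hl.integrableOn_isCompact isCompact_uIcc).intervalIntegrable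
  have hF : HasWeakDerivOn (Ioi 0) (fun x => ∫ t in (0 : ℝ)..x, w t) w :=
    .of_primitive hl fun x y => intervalIntegral.integral_interval_sub_left (hii _ _) (hii _ _)
  have hwv : w =ᵐ[volume.restrict (Ioi 0)] v := by
    rw [EventuallyEq, ae_restrict_iff' measurableSet_Ioi]
    exact Eventually.of_forall fun x hx => by simp [hw, mem_Ioi.1 hx]
  have hd := (h.add isOpen_Ioi (hF.smul (-1))).congr isOpen_Ioi (ae_eq_refl _)
    (v₁ := 0) (hwv.mono fun x hx => by simp [hx])
  obtain ⟨c, hc⟩ := hd.exists_ae_eq_const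
  refine ⟨c, ?_⟩
  rw [EventuallyEq, ae_restrict_iff' measurableSet_Ioi] at hc ⊢
  filter_upwards [hc] with x hx hx0
  have e : ∫ t in (0 : ℝ)..x, w t = ∫ t in (0 : ℝ)..x, v t := by
    rw [intervalIntegral.integral_of_le (le_of_lt hx0),
      intervalIntegral.integral_of_le (le_of_lt hx0)]
    exact setIntegral_congr_fun measurableSet_Ioc fun t ht => by simp [hw, ht.1]
  have := hx hx0
  simp only [Pi.add_apply, Pi.smul_apply, smul_eq_mul, e] at this
  linear_combination this

lemma MemLp.integrableOn_Ioc_zero {v : ℝ → ℂ} (hv : MemLp v 2 (volume.restrict (Ioi 0))) (R : ℝ) :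
    IntegrableOn v (Ioc 0 R) volume := by
  have h : MemLp v 2 (volume.restrict (Ioc 0 R)) :=
    hv.mono_measure (Measure.restrict_mono Ioc_subset_Ioi_self le_rfl)
  exact h.integrable (by norm_num)

/-! ### Green's formula on the positive half-line -/

/-- Green's formula on the half-line for indefinite integrals. -/
lemma green_of_primitive {u₁ p₁ w₁ u₂ p₂ w₂ : ℝ → ℂ}
    (hu₁ : MemLp u₁ 2 (volume.restrict (Ioi 0))) (hp₁ : MemLp p₁ 2 (volume.restrict (Ioi 0)))
    (hw₁ : MemLp w₁ 2 (volume.restrict (Ioi 0))) (hu₂ : MemLp u₂ 2 (volume.restrict (Ioi 0)))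
    (hp₂ : MemLp p₂ 2 (volume.restrict (Ioi 0))) (hw₂ : MemLp w₂ 2 (volume.restrict (Ioi 0)))
    (eu₁ : ∀ x, 0 ≤ x → u₁ x = u₁ 0 + ∫ t in (0 : ℝ)..x, p₁ t)
    (ep₁ : ∀ x, 0 ≤ x → p₁ x = p₁ 0 + ∫ t in (0 : ℝ)..x, w₁ t)
    (eu₂ : ∀ x, 0 ≤ x → u₂ x = u₂ 0 + ∫ t in (0 : ℝ)..x, p₂ t)
    (ep₂ : ∀ x, 0 ≤ x → p₂ x = p₂ 0 + ∫ t in (0 : ℝ)..x, w₂ t) :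
    ∫ x in Ioi (0 : ℝ), (w₁ x * u₂ x - u₁ x * w₂ x) = u₁ 0 * p₂ 0 - p₁ 0 * u₂ 0 := by
  have i1 : IntegrableOn (fun x => w₁ x * u₂ x - u₁ x * w₂ x) (Ioi 0) volume :=
    (hw₁.integrable_mul hu₂).sub (hu₁.integrable_mul hw₂)
  have i2 : IntegrableOn (fun x => p₁ x * u₂ x - u₁ x * p₂ x) (Ioi 0) volume :=
    (hp₁.integrable_mul hu₂).sub (hu₁.integrable_mul hp₂)
  have ii : ∀ {v : ℝ → ℂ}, MemLp v 2 (volume.restrict (Ioi 0)) → ∀ R, 0 ≤ R →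
      IntervalIntegrable v volume 0 R := fun hv R hR =>
    (intervalIntegrable_iff_integrableOn_Ioc_of_le hR).2 (MemLp.integrableOn_Ioc_zero hv R)
  have iprod : ∀ {v w : ℝ → ℂ}, MemLp v 2 (volume.restrict (Ioi 0)) →
      MemLp w 2 (volume.restrict (Ioi 0)) → ∀ R, 0 ≤ R →
      IntervalIntegrable (fun x => v x * w x) volume 0 R := fun hv hw R hR =>
    (intervalIntegrable_iff_integrableOn_Ioc_of_le hR).2
      (IntegrableOn.mono_set (hv.integrable_mul hw) Ioc_subset_Ioi_self)
  have key : ∀ R, 0 ≤ R → ∫ x in (0 : ℝ)..R, (w₁ x * u₂ x - u₁ x * w₂ x) =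
      (p₁ R * u₂ R - u₁ R * p₂ R) - (p₁ 0 * u₂ 0 - u₁ 0 * p₂ 0) := by
    intro R hR
    have k1 := integral_mul_add_mul_of_primitive hR (ii hw₁ R hR) (ii hp₂ R hR)
      (fun x hx => ep₁ x hx.1) (fun x hx => eu₂ x hx.1)
    have k2 := integral_mul_add_mul_of_primitive hR (ii hp₁ R hR) (ii hw₂ R hR)
      (fun x hx => eu₁ x hx.1) (fun x hx => ep₂ x hx.1)
    rw [intervalIntegral.integral_add (iprod hw₁ hu₂ R hR) (iprod hp₁ hp₂ R hR)] at k1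
    rw [intervalIntegral.integral_add (iprod hp₁ hp₂ R hR) (iprod hu₁ hw₂ R hR)] at k2
    rw [intervalIntegral.integral_sub (iprod hw₁ hu₂ R hR) (iprod hu₁ hw₂ R hR)]
    linear_combination k1 - k2
  have t1 := intervalIntegral_tendsto_integral_Ioi 0 i1 tendsto_id
  have t2 : Tendsto (fun R => p₁ R * u₂ R - u₁ R * p₂ R) atTop
      (𝓝 ((∫ x in Ioi (0 : ℝ), (w₁ x * u₂ x - u₁ x * w₂ x)) + (p₁ 0 * u₂ 0 - u₁ 0 * p₂ 0))) := by
    refine (t1.add_const (p₁ 0 * u₂ 0 - u₁ 0 * p₂ 0)).congr' ?_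
    filter_upwards [eventually_ge_atTop 0] with R hR
    rw [id, key R hR]
    ring
  -- The boundary expression at `R` has a limit by `t2` and is integrable as a combination of
  -- products of `L²` functions, so the limit is zero: nothing remains at infinity.
  have h0 := IntegrableAtFilter.eq_zero_of_tendsto (μ := volume) ⟨Ioi 0, Ioi_mem_atTop 0, i2⟩
    (fun s hs => by
      obtain ⟨b, hb⟩ := mem_atTop_sets.1 hs
      exact measure_mono_top (fun x hx => hb x hx) (Real.volume_Ici (a := b))) t2
  linear_combination h0

/-- A set of full measure meets every interval `(0, ε)`. This lets one-sided limits of almost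
everywhere equal functions be compared. -/
lemma frequently_of_ae_Ioi {P : ℝ → Prop} (h : ∀ᵐ x ∂(volume.restrict (Ioi (0 : ℝ))), P x) :
    ∃ᶠ x in 𝓝[>] (0 : ℝ), P x := by
  intro hn
  obtain ⟨ε, hε, hs⟩ := mem_nhdsGT_iff_exists_Ioo_subset.1 hn
  rw [ae_restrict_iff' measurableSet_Ioi] at h
  have : volume (Ioo (0 : ℝ) ε) = 0 := by
    refine measure_mono_null (fun x hx => ?_) h
    simp only [mem_compl_iff, mem_ofPred_eq]
    exact fun hc => hs hx (hc hx.1)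
  rw [Real.volume_Ioo, ENNReal.ofReal_eq_zero] at this
  have hε' : (0 : ℝ) < ε := hε
  linarith

/-- A function of class `H²` near `0` on the half-line is a twofold indefinite integral. -/
lemma exists_primitive_derivative {u p w : ℝ → ℂ} {a : ℂ} (hu : Continuous u)
    (hup : HasWeakDerivOn (Ioi 0) u p) (hpw : HasWeakDerivOn (Ioi 0) p w)
    (hw : MemLp w 2 (volume.restrict (Ioi 0))) (ha : HasDerivRight u a) :
    ∃ q : ℝ → ℂ, p =ᵐ[volume.restrict (Ioi 0)] q ∧ q 0 = a ∧
      (∀ x, 0 ≤ x → q x = q 0 + ∫ t in (0 : ℝ)..x, w t) ∧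
      ∀ x, 0 ≤ x → u x = u 0 + ∫ t in (0 : ℝ)..x, q t := by
  have hwl := locallyIntegrable_indicator_Ioi (MemLp.integrableOn_Ioc_zero hw)
  set w' := (Ioi (0 : ℝ)).indicator w with hw'
  have ew : ∀ x, 0 ≤ x → ∫ t in (0 : ℝ)..x, w' t = ∫ t in (0 : ℝ)..x, w t := fun x hx => by
    rw [intervalIntegral.integral_of_le hx, intervalIntegral.integral_of_le hx]
    exact setIntegral_congr_fun measurableSet_Ioc fun t ht => by simp [hw', ht.1]
  obtain ⟨c, hc⟩ := hpw.exists_ae_eq_primitive (MemLp.integrableOn_Ioc_zero hw)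
  set q : ℝ → ℂ := fun x => c + ∫ t in (0 : ℝ)..x, w' t with hq
  have hqc : Continuous q := continuous_const.add (intervalIntegral.continuous_primitive
    (fun a b => (hwl.integrableOn_isCompact isCompact_uIcc).intervalIntegrable) 0)
  have hpq : p =ᵐ[volume.restrict (Ioi 0)] q := by
    rw [EventuallyEq, ae_restrict_iff' measurableSet_Ioi] at hc ⊢
    filter_upwards [hc] with x hx hx0
    rw [hx hx0, hq]
    simp only [ew x (le_of_lt hx0)]
  have hq0 : q 0 = c := by simp [hq]
  -- The version of the derivative that realises `u'(0+) = a` agrees almost everywhere with the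
  -- continuous `q`, so both have the same limit at `0`.
  have hca : q 0 = a := by
    obtain ⟨v, hv, hva⟩ := ha
    have hvq : v =ᵐ[volume.restrict (Ioi 0)] q :=
      (hv.unique isOpen_Ioi hup (ae_eq_refl _)).trans hpq
    exact (tendsto_nhds_unique_of_frequently_eq hva
      (hqc.continuousAt.tendsto.mono_left nhdsWithin_le_nhds) (frequently_of_ae_Ioi hvq)).symm
  obtain ⟨d, hd⟩ := (hup.congr isOpen_Ioi (ae_eq_refl _) hpq).exists_ae_eq_primitive
    fun R => (hqc.integrableOn_Icc).mono_set Ioc_subset_Icc_self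
  have hdc : Continuous fun x => d + ∫ t in (0 : ℝ)..x, q t :=
    continuous_const.add (intervalIntegral.continuous_primitive
      (fun a b => hqc.intervalIntegrable a b) 0)
  have heq : EqOn u (fun x => d + ∫ t in (0 : ℝ)..x, q t) (Ici 0) := by
    rw [← closure_Ioi (0 : ℝ)]
    exact (Measure.eqOn_open_of_ae_eq hd isOpen_Ioi hu.continuousOn hdc.continuousOn).closure
      hu hdc
  have hd0 : u 0 = d := by rw [heq (mem_Ici.2 le_rfl)]; simp
  refine ⟨q, hpq, hca, fun x hx => ?_, fun x hx => ?_⟩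
  · rw [hq0, ← ew x hx]
  · rw [hd0, heq hx]

/-- Green's formula on `(0, ∞)`. -/
lemma green_Ioi {u₁ w₁ u₂ w₂ : ℝ → ℂ} {a₁ a₂ : ℂ} (hc₁ : Continuous u₁) (hc₂ : Continuous u₂)
    (hm₁ : MemH2 (Ioi 0) u₁) (hm₂ : MemH2 (Ioi 0) u₂)
    (hd₁ : ∃ v, HasWeakDerivOn (Ioi 0) u₁ v ∧ HasWeakDerivOn (Ioi 0) v w₁)
    (hd₂ : ∃ v, HasWeakDerivOn (Ioi 0) u₂ v ∧ HasWeakDerivOn (Ioi 0) v w₂)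
    (ha₁ : HasDerivRight u₁ a₁) (ha₂ : HasDerivRight u₂ a₂) :
    ∫ x in Ioi (0 : ℝ), (conj (w₁ x) * u₂ x - conj (u₁ x) * w₂ x) =
      conj (u₁ 0) * a₂ - conj a₁ * u₂ 0 := by
  have rep : ∀ {u w : ℝ → ℂ} {a : ℂ}, Continuous u → MemH2 (Ioi 0) u →
      (∃ v, HasWeakDerivOn (Ioi 0) u v ∧ HasWeakDerivOn (Ioi 0) v w) → HasDerivRight u a →
      ∃ q : ℝ → ℂ, MemLp u 2 (volume.restrict (Ioi 0)) ∧ MemLp q 2 (volume.restrict (Ioi 0)) ∧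
        MemLp w 2 (volume.restrict (Ioi 0)) ∧ q 0 = a ∧
        (∀ x, 0 ≤ x → q x = q 0 + ∫ t in (0 : ℝ)..x, w t) ∧
        ∀ x, 0 ≤ x → u x = u 0 + ∫ t in (0 : ℝ)..x, q t := by
    rintro u w a hc ⟨mu, p, r, mp, mr, hup, hpr⟩ ⟨v, huv, hvw⟩ ha
    have hvp := huv.unique isOpen_Ioi hup (ae_eq_refl _)
    have hwr := hvw.unique isOpen_Ioi hpr hvp
    have mw : MemLp w 2 (volume.restrict (Ioi 0)) := mr.ae_eq hwr.symm
    obtain ⟨q, e1, e2, e3, e4⟩ := exists_primitive_derivative hc huv hvw mw ha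
    exact ⟨q, mu, mp.ae_eq (hvp.symm.trans e1), mw, e2, e3, e4⟩
  obtain ⟨q₁, mu₁, mq₁, mw₁, rfl, eq₁, eu₁⟩ := rep hc₁ hm₁ hd₁ ha₁
  obtain ⟨q₂, mu₂, mq₂, mw₂, rfl, eq₂, eu₂⟩ := rep hc₂ hm₂ hd₂ ha₂
  refine green_of_primitive (u₁ := fun x => conj (u₁ x)) (p₁ := fun x => conj (q₁ x))
    (w₁ := fun x => conj (w₁ x)) mu₁.star mq₁.star mw₁.star mu₂ mq₂ mw₂ ?_ ?_ eu₂ eq₂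
  · intro x hx
    rw [intervalIntegral.integral_of_le hx, integral_conj, ← intervalIntegral.integral_of_le hx,
      ← map_add, ← eu₁ x hx]
  · intro x hx
    rw [intervalIntegral.integral_of_le hx, integral_conj, ← intervalIntegral.integral_of_le hx,
      ← map_add, ← eq₁ x hx]

/-! ### Transfer to the negative half-line by reflection -/

section Reflection

variable {u v : ℝ → ℂ}

lemma measurePreserving_neg_halfLine :
    MeasurePreserving (fun x : ℝ => -x) (volume.restrict (Ioi 0)) (volume.restrict (Iio 0)) := by
  have h := (Measure.measurePreserving_neg (volume : Measure ℝ)).restrict_preimage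
    (measurableSet_Iio (a := (0 : ℝ)))
  have e : (Neg.neg : ℝ → ℝ) ⁻¹' (Iio 0) = Ioi 0 := by ext; simp
  rwa [e] at h

lemma setIntegral_Ioi_comp_neg (f : ℝ → ℂ) :
    ∫ x in Ioi (0 : ℝ), f (-x) = ∫ x in Iio (0 : ℝ), f x := by
  rw [integral_comp_neg_Ioi, neg_zero, integral_Iic_eq_integral_Iio]

lemma locallyIntegrableOn_comp_neg (hu : LocallyIntegrableOn u (Iio 0) volume) :
    LocallyIntegrableOn (fun x => u (-x)) (Ioi 0) volume := by
  rw [locallyIntegrableOn_iff isOpen_Ioi.isLocallyClosed]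
  rw [locallyIntegrableOn_iff isOpen_Iio.isLocallyClosed] at hu
  intro k hk hkc
  have h := hu (Neg.neg ⁻¹' k) (fun x hx => by simpa using hk hx)
    (by simpa using hkc.neg)
  have := ((Measure.measurePreserving_neg (volume : Measure ℝ)).integrableOn_comp_preimage
    (Homeomorph.neg ℝ).measurableEmbedding).2 h
  rw [← preimage_comp] at this
  simpa [Function.comp_def] using this

lemma HasWeakDerivOn.comp_neg (h : HasWeakDerivOn (Iio 0) u v) :
    HasWeakDerivOn (Ioi 0) (fun x => u (-x)) (fun x => -v (-x)) := by
  refine ⟨locallyIntegrableOn_comp_neg h.1, (locallyIntegrableOn_comp_neg h.2.1).neg,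
    fun φ hφ hc hs => ?_⟩
  have e := h.2.2 (fun x => φ (-x)) (hφ.comp contDiff_neg)
    (hc.comp_homeomorph (Homeomorph.neg ℝ)) (by
      intro x hx
      have := tsupport_comp_subset_preimage φ (f := fun x : ℝ => -x) continuous_neg hx
      simpa using hs this)
  have hd : deriv (fun x => φ (-x)) = fun x => -deriv φ (-x) := funext fun x => deriv_comp_neg φ x
  rw [hd, ← setIntegral_Ioi_comp_neg, ← setIntegral_Ioi_comp_neg] at e
  simp only [neg_neg, neg_smul, integral_neg, neg_inj] at e
  simp only [smul_neg, integral_neg, neg_neg, e]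

lemma HasWeakDerivOn.neg_comp_neg (h : HasWeakDerivOn (Iio 0) u v) :
    HasWeakDerivOn (Ioi 0) (fun x => -u (-x)) (fun x => v (-x)) := by
  have e : (fun x => v (-x)) = (-1 : ℂ) • fun x => -v (-x) := by funext x; simp
  have e' : (fun x => -u (-x)) = (-1 : ℂ) • fun x => u (-x) := by funext x; simp
  rw [e, e']
  exact h.comp_neg.smul (-1)

lemma MemH2.comp_neg (h : MemH2 (Iio 0) u) : MemH2 (Ioi 0) fun x => u (-x) := by
  obtain ⟨a, p, q, hp, hq, hup, hpq⟩ := h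
  have hm := measurePreserving_neg_halfLine
  exact ⟨a.comp_measurePreserving hm, _, _, (hp.comp_measurePreserving hm).neg,
    hq.comp_measurePreserving hm, hup.comp_neg, hpq.neg_comp_neg⟩

lemma HasDerivLeft.comp_neg {b : ℂ} (h : HasDerivLeft u b) :
    HasDerivRight (fun x => u (-x)) (-b) := by
  obtain ⟨v, hv, ht⟩ := h
  refine ⟨_, hv.comp_neg, (ht.comp ?_).neg⟩
  simpa using tendsto_neg_nhdsGT (a := (0 : ℝ))

/-- Green's formula on `(-∞, 0)`. -/
lemma green_Iio {u₁ w₁ u₂ w₂ : ℝ → ℂ} {b₁ b₂ : ℂ} (hc₁ : Continuous u₁) (hc₂ : Continuous u₂)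
    (hm₁ : MemH2 (Iio 0) u₁) (hm₂ : MemH2 (Iio 0) u₂)
    (hd₁ : ∃ v, HasWeakDerivOn (Iio 0) u₁ v ∧ HasWeakDerivOn (Iio 0) v w₁)
    (hd₂ : ∃ v, HasWeakDerivOn (Iio 0) u₂ v ∧ HasWeakDerivOn (Iio 0) v w₂)
    (hb₁ : HasDerivLeft u₁ b₁) (hb₂ : HasDerivLeft u₂ b₂) :
    ∫ x in Iio (0 : ℝ), (conj (w₁ x) * u₂ x - conj (u₁ x) * w₂ x) =
      conj b₁ * u₂ 0 - conj (u₁ 0) * b₂ := by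
  have two : ∀ {u w : ℝ → ℂ}, (∃ v, HasWeakDerivOn (Iio 0) u v ∧ HasWeakDerivOn (Iio 0) v w) →
      ∃ v, HasWeakDerivOn (Ioi 0) (fun x => u (-x)) v ∧
        HasWeakDerivOn (Ioi 0) v fun x => w (-x) := by
    rintro u w ⟨v, h1, h2⟩
    exact ⟨_, h1.comp_neg, h2.neg_comp_neg⟩
  have h := green_Ioi (hc₁.comp continuous_neg) (hc₂.comp continuous_neg) hm₁.comp_neg
    hm₂.comp_neg (two hd₁) (two hd₂) hb₁.comp_neg hb₂.comp_neg
  rw [← setIntegral_Ioi_comp_neg]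
  simp only [Function.comp_def, neg_zero, map_neg] at h
  rw [h]
  ring

end Reflection

/-! ### Derivative jumps and Green's formula across the origin -/

/-- The jump `u'(0+) - u'(0-)` of the derivative of `u` at `0` is `j`. -/
def HasJump (u : ℝ → ℂ) (j : ℂ) : Prop :=
  ∃ a b : ℂ, HasDerivRight u a ∧ HasDerivLeft u b ∧ j = a - b

lemma HasJump.add {u v : ℝ → ℂ} {j k : ℂ} (hu : HasJump u j) (hv : HasJump v k) :
    HasJump (u + v) (j + k) := by
  obtain ⟨a, b, ⟨p, hp, ha⟩, ⟨q, hq, hb⟩, rfl⟩ := hu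
  obtain ⟨a', b', ⟨p', hp', ha'⟩, ⟨q', hq', hb'⟩, rfl⟩ := hv
  exact ⟨a + a', b + b', ⟨_, hp.add isOpen_Ioi hp', ha.add ha'⟩,
    ⟨_, hq.add isOpen_Iio hq', hb.add hb'⟩, by ring⟩

lemma HasJump.smul {u : ℝ → ℂ} {j : ℂ} (c : ℂ) (hu : HasJump u j) :
    HasJump (c • u) (c * j) := by
  obtain ⟨a, b, ⟨p, hp, ha⟩, ⟨q, hq, hb⟩, rfl⟩ := hu
  exact ⟨c * a, c * b, ⟨_, hp.smul c, ha.const_smul c⟩, ⟨_, hq.smul c, hb.const_smul c⟩, by ring⟩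

/-- Green's formula in `𝒲(ℝ)`. -/
lemma W.inner_secondDeriv_sub {u v : W} {j k : ℂ} (hu : HasJump u j) (hv : HasJump v k) :
    inner ℂ (W.secondDeriv u) (W.toL2 v) - inner ℂ (W.toL2 u) (W.secondDeriv v) =
      conj ((u : ℝ → ℂ) 0) * k - conj j * (v : ℝ → ℂ) 0 := by
  obtain ⟨a, b, ha, hb, rfl⟩ := hu
  obtain ⟨a', b', ha', hb', rfl⟩ := hv
  have gr := green_Ioi u.2.1 v.2.1 u.2.2.2 v.2.2.2 (W.isSecondDeriv u).2 (W.isSecondDeriv v).2 ha ha'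
  have gl := green_Iio u.2.1 v.2.1 u.2.2.1 v.2.2.1 (W.isSecondDeriv u).1 (W.isSecondDeriv v).1 hb hb'
  have eu : W.toL2 u =ᵐ[volume] (u : ℝ → ℂ) := (W.memLp u).coeFn_toLp
  have ev : W.toL2 v =ᵐ[volume] (v : ℝ → ℂ) := (W.memLp v).coeFn_toLp
  rw [L2.inner_def, L2.inner_def, ← integral_sub (L2.integrable_inner _ _)
    (L2.integrable_inner _ _)]
  set f : ℝ → ℂ := fun x => conj (W.secondDeriv u x) * (v : ℝ → ℂ) x -
    conj ((u : ℝ → ℂ) x) * W.secondDeriv v x with hf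
  have hfe : (fun x => inner ℂ (W.secondDeriv u x) (W.toL2 v x) -
      inner ℂ (W.toL2 u x) (W.secondDeriv v x)) =ᵐ[volume] f := by
    filter_upwards [eu, ev] with x h1 h2
    simp only [RCLike.inner_apply, h1, h2, hf]
    ring
  have hfi : Integrable f volume :=
    ((L2.integrable_inner (𝕜 := ℂ) (W.secondDeriv u) (W.toL2 v)).sub
      (L2.integrable_inner (W.toL2 u) (W.secondDeriv v))).congr hfe
  rw [integral_congr_ae hfe, ← integral_add_compl (measurableSet_Ioi (a := (0 : ℝ))) hfi,
    compl_Ioi, integral_Iic_eq_integral_Iio, gr, gl, map_sub]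
  ring

lemma HasWeakDerivOn.of_hasDerivAt {I : Set ℝ} {F f : ℝ → ℂ} (hf : Continuous f)
    (h : ∀ x, HasDerivAt F (f x) x) : HasWeakDerivOn I F f :=
  .of_primitive hf.locallyIntegrable fun x y =>
    (intervalIntegral.integral_eq_sub_of_hasDerivAt (fun t _ => h t)
      (hf.intervalIntegrable x y)).symm

/-- The product of a smooth function and a weakly differentiable one. -/
lemma HasWeakDerivOn.contDiff_smul {I : Set ℝ} (hI : IsOpen I) {u v : ℝ → ℂ}
    (h : HasWeakDerivOn I u v) {E : ℝ → ℝ} (hE : ContDiff ℝ ∞ E) :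
    HasWeakDerivOn I (fun x => E x • u x) (fun x => deriv E x • u x + E x • v x) := by
  have hE' : Continuous (deriv E) := hE.continuous_deriv (by simp)
  have l1 : LocallyIntegrableOn (fun x => E x • u x) I volume :=
    h.1.continuousOn_smul hI.isLocallyClosed hE.continuous.continuousOn
  have l2 : LocallyIntegrableOn (fun x => deriv E x • u x) I volume :=
    h.1.continuousOn_smul hI.isLocallyClosed hE'.continuousOn
  have l3 : LocallyIntegrableOn (fun x => E x • v x) I volume :=
    h.2.1.continuousOn_smul hI.isLocallyClosed hE.continuous.continuousOn
  refine ⟨l1, l2.add l3, fun φ hφ hc hs => ?_⟩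
  have hts : tsupport (fun x => φ x * E x) ⊆ I := tsupport_mul_subset_left.trans hs
  have e := h.2.2 (fun x => φ x * E x) (hφ.mul hE) hc.mul_right hts
  have hd : ∀ x, deriv (fun x => φ x * E x) x = deriv φ x * E x + φ x * deriv E x := fun x =>
    ((hφ.differentiable (by simp) x).hasDerivAt.mul
      (hE.differentiable (by simp) x).hasDerivAt).deriv
  have i1 := integrableOn_deriv_smul hI l1 hφ hc hs
  have i2 := integrableOn_smul hI l2 hφ.continuous hc hs
  have i3 := integrableOn_smul hI l3 hφ.continuous hc hs
  simp only [hd, add_smul, mul_smul] at e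
  rw [integral_add i1 i2] at e
  simp only [smul_add]
  rw [integral_add i2 i3]
  linear_combination e

/-! ### The decaying exponentials -/

section Exponential

/-- The function `x ↦ exp (-t |x|)`. -/
def expAbs (t : ℝ) (x : ℝ) : ℂ := (Real.exp (-t * |x|) : ℂ)

lemma expAbs_zero (t : ℝ) : expAbs t 0 = 1 := by simp [expAbs]

lemma continuous_expAbs (t : ℝ) : Continuous (expAbs t) := by
  unfold expAbs; fun_prop

lemma integrable_exp_neg_mul_abs {t : ℝ} (ht : 0 < t) :
    Integrable (fun x : ℝ => Real.exp (-t * |x|)) volume := by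
  have h1 : IntegrableOn (fun x : ℝ => Real.exp (-t * |x|)) (Ioi 0) volume :=
    (integrableOn_exp_mul_Ioi (a := -t) (by linarith) 0).congr_fun
      (fun x hx => by simp only [abs_of_pos (mem_Ioi.1 hx)]) measurableSet_Ioi
  have h2 : IntegrableOn (fun x : ℝ => Real.exp (-t * |x|)) (Iic 0) volume :=
    (integrableOn_exp_mul_Iic ht 0).congr_fun
      (fun x hx => by simp only [abs_of_nonpos (mem_Iic.1 hx), neg_mul_neg]) measurableSet_Iic
  rw [← integrableOn_univ, ← Iic_union_Ioi (a := (0 : ℝ))]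
  exact h2.union h1

lemma norm_expAbs_sq (t x : ℝ) : ‖expAbs t x‖ ^ 2 = Real.exp (-(2 * t) * |x|) := by
  rw [expAbs, Complex.norm_real, Real.norm_of_nonneg (Real.exp_pos _).le, ← Real.exp_nat_mul]
  congr 1
  push_cast
  ring

lemma memLp_expAbs {t : ℝ} (ht : 0 < t) : MemLp (expAbs t) 2 volume := by
  rw [memLp_two_iff_integrable_sq_norm (continuous_expAbs t).aestronglyMeasurable]
  simp only [norm_expAbs_sq]
  exact integrable_exp_neg_mul_abs (by linarith)

lemma hasWeakDerivOn_expReal {I : Set ℝ} (s : ℝ) :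
    HasWeakDerivOn I (fun x => (Real.exp (s * x) : ℂ)) ((s : ℂ) • fun x => (Real.exp (s * x) : ℂ)) := by
  refine .of_hasDerivAt (by fun_prop) fun x => ?_
  have h : HasDerivAt (fun x => Real.exp (s * x)) (Real.exp (s * x) * (s * 1)) x :=
    ((hasDerivAt_id x).const_mul s).exp
  convert h.ofReal_comp using 1
  simp [mul_comm]

lemma expAbs_ae_eq_Ioi (t : ℝ) :
    (fun x => (Real.exp (-t * x) : ℂ)) =ᵐ[volume.restrict (Ioi 0)] expAbs t := by
  rw [EventuallyEq, ae_restrict_iff' measurableSet_Ioi]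
  exact Eventually.of_forall fun x hx => by rw [expAbs, abs_of_pos hx]

lemma expAbs_ae_eq_Iio (t : ℝ) :
    (fun x => (Real.exp (t * x) : ℂ)) =ᵐ[volume.restrict (Iio 0)] expAbs t := by
  rw [EventuallyEq, ae_restrict_iff' measurableSet_Iio]
  exact Eventually.of_forall fun x hx => by rw [expAbs, abs_of_neg hx]; simp

lemma hasWeakDerivOn_expAbs_Ioi (t : ℝ) :
    HasWeakDerivOn (Ioi 0) (expAbs t) (((-t : ℝ) : ℂ) • expAbs t) :=
  (hasWeakDerivOn_expReal (-t)).congr isOpen_Ioi (expAbs_ae_eq_Ioi t)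
    ((expAbs_ae_eq_Ioi t).const_smul ((-t : ℝ) : ℂ))

lemma hasWeakDerivOn_expAbs_Iio (t : ℝ) :
    HasWeakDerivOn (Iio 0) (expAbs t) ((t : ℂ) • expAbs t) :=
  (hasWeakDerivOn_expReal t).congr isOpen_Iio (expAbs_ae_eq_Iio t)
    ((expAbs_ae_eq_Iio t).const_smul (t : ℂ))

lemma expAbs_mem_W {t : ℝ} (ht : 0 < t) : expAbs t ∈ W := by
  have m := memLp_expAbs ht
  exact ⟨continuous_expAbs t,
    ⟨m.restrict _, _, _, (m.restrict _).const_smul _, ((m.restrict _).const_smul _).const_smul _,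
      hasWeakDerivOn_expAbs_Iio t, (hasWeakDerivOn_expAbs_Iio t).smul _⟩,
    ⟨m.restrict _, _, _, (m.restrict _).const_smul _, ((m.restrict _).const_smul _).const_smul _,
      hasWeakDerivOn_expAbs_Ioi t, (hasWeakDerivOn_expAbs_Ioi t).smul _⟩⟩

lemma hasJump_expAbs (t : ℝ) : HasJump (expAbs t) (-2 * t) := by
  have h : Tendsto (expAbs t) (𝓝 0) (𝓝 1) := by
    simpa [expAbs_zero] using (continuous_expAbs t).tendsto 0
  refine ⟨(-t : ℝ), t, ⟨_, hasWeakDerivOn_expAbs_Ioi t, ?_⟩, ⟨_, hasWeakDerivOn_expAbs_Iio t, ?_⟩,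
    by push_cast; ring⟩
  · have := (h.mono_left (nhdsWithin_le_nhds (s := Ioi 0))).const_smul ((-t : ℝ) : ℂ)
    rwa [smul_eq_mul, mul_one] at this
  · have := (h.mono_left (nhdsWithin_le_nhds (s := Iio 0))).const_smul (t : ℂ)
    rwa [smul_eq_mul, mul_one] at this

/-- The function `x ↦ exp (-t |x|)` as an element of `𝒲(ℝ)`. -/
def W.exp (t : ℝ) (ht : 0 < t) : W := ⟨expAbs t, expAbs_mem_W ht⟩

lemma W.secondDeriv_exp {t : ℝ} (ht : 0 < t) :
    W.secondDeriv (W.exp t ht) = ((t ^ 2 : ℝ) : ℂ) • W.toL2 (W.exp t ht) := by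
  refine (W.isSecondDeriv _).unique ?_
  have e1 : ((t ^ 2 : ℝ) : ℂ) • W.toL2 (W.exp t ht) =ᵐ[volume] ((t ^ 2 : ℝ) : ℂ) • expAbs t :=
    (Lp.coeFn_smul _ _).trans ((memLp_expAbs ht).coeFn_toLp.const_smul _)
  refine ⟨⟨_, hasWeakDerivOn_expAbs_Iio t, ((hasWeakDerivOn_expAbs_Iio t).smul _).congr isOpen_Iio
    (ae_eq_refl _) (ae_restrict_of_ae (EventuallyEq.trans ?_ e1.symm))⟩,
    ⟨_, hasWeakDerivOn_expAbs_Ioi t, ((hasWeakDerivOn_expAbs_Ioi t).smul _).congr isOpen_Ioi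
    (ae_eq_refl _) (ae_restrict_of_ae (EventuallyEq.trans ?_ e1.symm))⟩⟩
  · rw [smul_smul]; push_cast; rw [sq]
  · rw [smul_smul]; push_cast; rw [sq, neg_mul_neg]

lemma W.norm_exp_sq {t : ℝ} (ht : 0 < t) : ‖W.toL2 (W.exp t ht)‖ ^ 2 = 1 / t := by
  have e : (∫ x, ‖expAbs t x‖ ^ 2) = 1 / t := by
    simp only [norm_expAbs_sq]
    rw [integral_comp_abs (f := fun x => Real.exp (-(2 * t) * x)),
      integral_exp_mul_Ioi (by linarith)]
    simp
    field_simp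
  have h : inner ℂ (W.toL2 (W.exp t ht)) (W.toL2 (W.exp t ht)) = ((1 / t : ℝ) : ℂ) := by
    rw [L2.inner_def, ← e, ← integral_complex_ofReal]
    refine integral_congr_ae ?_
    filter_upwards [(memLp_expAbs ht).coeFn_toLp] with x hx
    have hx' : W.toL2 (W.exp t ht) x = expAbs t x := hx
    rw [hx', inner_self_eq_norm_sq_to_K]
    norm_cast
  rw [← inner_self_eq_norm_sq (𝕜 := ℂ), h]
  exact Complex.ofReal_re _

end Exponential

/-! ### The free resolvent on the line -/

section Resolvent

/-- Young's inequality for the convolution of a summable and a square-summable function. -/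
lemma lintegral_convolution_sq_le {k h : ℝ → ℝ≥0∞} (hk : Measurable k) (hh : AEMeasurable h volume) :
    ∫⁻ x, (∫⁻ y, k (x - y) * h y) ^ 2 ≤ (∫⁻ x, k x) ^ 2 * ∫⁻ y, h y ^ 2 := by
  set K := ∫⁻ x, k x
  have hp : (2 : ℝ).HolderConjugate 2 := by
    constructor <;> norm_num
  have step : ∀ x, (∫⁻ y, k (x - y) * h y) ^ 2 ≤ K * ∫⁻ y, k (x - y) * h y ^ 2 := by
    intro x
    have hkx : Measurable fun y => k (x - y) := hk.comp (measurable_const.sub measurable_id)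
    -- Splitting `k = k^(1/2) k^(1/2)` and applying Cauchy–Schwarz leaves one full factor of `k`
    -- next to `h ^ 2`, ready for Tonelli.
    have e1 : ∀ y, k (x - y) * h y =
        ((fun y => k (x - y) ^ (1 / 2 : ℝ)) * fun y => k (x - y) ^ (1 / 2 : ℝ) * h y) y := by
      intro y
      simp only [Pi.mul_apply]
      rw [← mul_assoc, ← ENNReal.rpow_add_of_nonneg _ _ (by norm_num) (by norm_num)]
      norm_num
    have hol := ENNReal.lintegral_mul_le_Lp_mul_Lq volume hp
      (f := fun y => k (x - y) ^ (1 / 2 : ℝ)) (g := fun y => k (x - y) ^ (1 / 2 : ℝ) * h y)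
      (hkx.pow_const _).aemeasurable ((hkx.pow_const _).aemeasurable.mul hh)
    rw [lintegral_congr e1]
    refine (pow_le_pow_left₀ zero_le hol 2).trans (le_of_eq ?_)
    rw [mul_pow, ← ENNReal.rpow_natCast, ← ENNReal.rpow_natCast, ← ENNReal.rpow_mul,
      ← ENNReal.rpow_mul]
    norm_num
    congr 1
    · have : ∀ y, (k (x - y) ^ (1 / 2 : ℝ)) ^ (2 : ℕ) = k (x - y) := fun y => by
        rw [← ENNReal.rpow_natCast, ← ENNReal.rpow_mul]; norm_num
      simp only [this]
      exact lintegral_sub_left_eq_self k x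
    · refine lintegral_congr fun y => ?_
      rw [mul_pow]
      congr 1
      rw [← ENNReal.rpow_natCast, ← ENNReal.rpow_mul]; norm_num
  have hm : AEMeasurable (fun z : ℝ × ℝ => k (z.1 - z.2) * h z.2 ^ 2) (volume.prod volume) :=
    (hk.comp (measurable_fst.sub measurable_snd)).aemeasurable.mul
      ((hh.pow_const 2).comp_quasiMeasurePreserving Measure.quasiMeasurePreserving_snd)
  calc ∫⁻ x, (∫⁻ y, k (x - y) * h y) ^ 2 ≤ ∫⁻ x, K * ∫⁻ y, k (x - y) * h y ^ 2 :=
        lintegral_mono step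
    _ = K * ∫⁻ x, ∫⁻ y, k (x - y) * h y ^ 2 := by
        rw [lintegral_const_mul'' _ hm.lintegral_prod_right']
    _ = K * ∫⁻ y, ∫⁻ x, k (x - y) * h y ^ 2 := by
        rw [lintegral_lintegral_swap hm]
    _ = K * ∫⁻ y, K * h y ^ 2 := by
        congr 1
        refine lintegral_congr fun y => ?_
        rw [lintegral_mul_const (f := fun x => k (x - y)) _ (hk.comp (measurable_id.sub_const y)),
          lintegral_sub_right_eq_self k y]
    _ = K ^ 2 * ∫⁻ y, h y ^ 2 := by
        rw [lintegral_const_mul'' _ (hh.pow_const 2), sq, mul_assoc]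

variable {κ : ℝ} {g : ℝ → ℂ}

lemma integrableOn_exp_smul_Iic (hκ : 0 < κ) (hg : MemLp g 2 volume) (x : ℝ) :
    IntegrableOn (fun y => Real.exp (κ * y) • g y) (Iic x) volume := by
  have h : MemLp (fun y => Real.exp (κ * y)) 2 (volume.restrict (Iic x)) := by
    rw [memLp_two_iff_integrable_sq (by fun_prop)]
    refine (integrableOn_exp_mul_Iic (a := 2 * κ) (by linarith) x).congr
      (Eventually.of_forall fun y => ?_)
    simp only [← Real.exp_nat_mul]
    congr 1
    push_cast
    ring
  exact memLp_one_iff_integrable.1 ((hg.restrict (Iic x)).smul h)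

lemma integrableOn_exp_smul_Ioi (hκ : 0 < κ) (hg : MemLp g 2 volume) (x : ℝ) :
    IntegrableOn (fun y => Real.exp (-κ * y) • g y) (Ioi x) volume := by
  have h : MemLp (fun y => Real.exp (-κ * y)) 2 (volume.restrict (Ioi x)) := by
    rw [memLp_two_iff_integrable_sq (by fun_prop)]
    refine (integrableOn_exp_mul_Ioi (a := -(2 * κ)) (by linarith) x).congr
      (Eventually.of_forall fun y => ?_)
    simp only [← Real.exp_nat_mul]
    congr 1
    push_cast
    ring
  exact memLp_one_iff_integrable.1 ((hg.restrict (Ioi x)).smul h)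

/-- The solution `∫_{y ≤ x} exp (-κ (x - y)) g(y) dy` of `P' = -κ P + g`. -/
def resolventLeft (κ : ℝ) (g : ℝ → ℂ) (x : ℝ) : ℂ :=
  Real.exp (-κ * x) • ∫ y in Iic x, Real.exp (κ * y) • g y

/-- The solution `∫_{y > x} exp (-κ (y - x)) g(y) dy` of `Q' = κ Q - g`. -/
def resolventRight (κ : ℝ) (g : ℝ → ℂ) (x : ℝ) : ℂ :=
  Real.exp (κ * x) • ∫ y in Ioi x, Real.exp (-κ * y) • g y

lemma locallyIntegrable_exp_smul (hg : MemLp g 2 volume) (s : ℝ) :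
    LocallyIntegrable (fun y => Real.exp (s * y) • g y) volume := by
  have := (hg.locallyIntegrable (by norm_num)).continuous_smul
    (g := fun y => Real.exp (s * y)) (by fun_prop)
  exact this

lemma primitive_resolventLeft (hκ : 0 < κ) (hg : MemLp g 2 volume) (x y : ℝ) :
    (∫ t in Iic y, Real.exp (κ * t) • g t) - ∫ t in Iic x, Real.exp (κ * t) • g t =
      ∫ t in x..y, Real.exp (κ * t) • g t :=
  intervalIntegral.integral_Iic_sub_Iic (integrableOn_exp_smul_Iic hκ hg x)
    (integrableOn_exp_smul_Iic hκ hg y)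

lemma primitive_resolventRight (hκ : 0 < κ) (hg : MemLp g 2 volume) (x y : ℝ) :
    (-∫ t in Ioi y, Real.exp (-κ * t) • g t) - -∫ t in Ioi x, Real.exp (-κ * t) • g t =
      ∫ t in x..y, Real.exp (-κ * t) • g t := by
  rw [← intervalIntegral.integral_interval_add_Ioi (integrableOn_exp_smul_Ioi hκ hg x)
    (integrableOn_exp_smul_Ioi hκ hg y)]
  ring

lemma continuous_resolventLeft (hκ : 0 < κ) (hg : MemLp g 2 volume) :
    Continuous (resolventLeft κ g) :=
  Continuous.smul (f := fun x => Real.exp (-κ * x)) (by fun_prop) (continuous_of_primitive (locallyIntegrable_exp_smul hg κ)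
    (primitive_resolventLeft hκ hg))

lemma continuous_resolventRight (hκ : 0 < κ) (hg : MemLp g 2 volume) :
    Continuous (resolventRight κ g) := by
  have h := (continuous_of_primitive (locallyIntegrable_exp_smul hg (-κ))
    (F := fun x => -∫ t in Ioi x, Real.exp (-κ * t) • g t) (primitive_resolventRight hκ hg)).neg
  refine Continuous.smul (f := fun x => Real.exp (κ * x)) (by fun_prop) (h.congr fun x => ?_)
  exact neg_neg _

lemma contDiff_exp_mul (s : ℝ) : ContDiff ℝ ∞ fun x : ℝ => Real.exp (s * x) :=
  (contDiff_const.mul contDiff_id).exp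

lemma deriv_exp_mul (s x : ℝ) : deriv (fun x : ℝ => Real.exp (s * x)) x = s * Real.exp (s * x) := by
  have h : HasDerivAt (fun x => Real.exp (s * x)) (Real.exp (s * x) * (s * 1)) x :=
    ((hasDerivAt_id x).const_mul s).exp
  rw [h.deriv]
  ring

lemma hasWeakDerivOn_resolventLeft {I : Set ℝ} (hI : IsOpen I) (hκ : 0 < κ)
    (hg : MemLp g 2 volume) :
    HasWeakDerivOn I (resolventLeft κ g) ((-κ : ℂ) • resolventLeft κ g + g) := by
  have h := (HasWeakDerivOn.of_primitive (I := I) (locallyIntegrable_exp_smul hg κ)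
    (primitive_resolventLeft hκ hg)).contDiff_smul hI (contDiff_exp_mul (-κ))
  change HasWeakDerivOn I (resolventLeft κ g) _ at h
  convert h using 1
  funext x
  simp only [Pi.smul_apply, Pi.add_apply]
  rw [deriv_exp_mul, smul_smul (Real.exp _), ← Real.exp_add,
    show -κ * x + κ * x = 0 by ring, Real.exp_zero, one_smul]
  simp [resolventLeft, mul_assoc]

lemma hasWeakDerivOn_resolventRight {I : Set ℝ} (hI : IsOpen I) (hκ : 0 < κ)
    (hg : MemLp g 2 volume) :
    HasWeakDerivOn I (resolventRight κ g) ((κ : ℂ) • resolventRight κ g + (-1 : ℂ) • g) := by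
  have h := ((HasWeakDerivOn.of_primitive (I := I) (locallyIntegrable_exp_smul hg (-κ))
    (primitive_resolventRight hκ hg)).contDiff_smul hI (contDiff_exp_mul κ)).smul (-1)
  convert h using 1
  · funext x
    simp [resolventRight]
  · funext x
    simp only [Pi.smul_apply, Pi.add_apply]
    rw [deriv_exp_mul, smul_smul, ← Real.exp_add, neg_mul, add_neg_cancel, Real.exp_zero, one_smul]
    simp [resolventRight, mul_assoc]
    ring

/-- The kernel `exp (-κ |x|)` is integrable, so Young's inequality applies; both one-sided resolvent
integrals are dominated by this convolution. -/
lemma memLp_of_enorm_le_convolution (hκ : 0 < κ) (hg : MemLp g 2 volume) {F : ℝ → ℂ}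
    (hF : Continuous F)
    (h : ∀ x, ‖F x‖ₑ ≤ ∫⁻ y, ENNReal.ofReal (Real.exp (-κ * |x - y|)) * ‖g y‖ₑ) :
    MemLp F 2 volume := by
  have fin : ∀ {G : ℝ → ℂ}, AEStronglyMeasurable G volume →
      (MemLp G 2 volume ↔ ∫⁻ x, ‖G x‖ₑ ^ 2 < ⊤) := fun {G} hG => by
    rw [MemLp, eLpNorm_lt_top_iff_lintegral_rpow_enorm_lt_top (by norm_num) (by norm_num)]
    simp [hG]
  rw [fin hF.aestronglyMeasurable]
  have hgf := (fin hg.1).1 hg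
  have hK : ∫⁻ x, ENNReal.ofReal (Real.exp (-κ * |x|)) < ⊤ :=
    ((hasFiniteIntegral_iff_ofReal (Eventually.of_forall fun x => (Real.exp_pos _).le)).1
      (integrable_exp_neg_mul_abs hκ).2)
  refine lt_of_le_of_lt (lintegral_mono fun x => pow_le_pow_left₀ zero_le (h x) 2) ?_
  refine lt_of_le_of_lt (lintegral_convolution_sq_le
    (k := fun x => ENNReal.ofReal (Real.exp (-κ * |x|))) (by fun_prop) hg.1.enorm) ?_
  exact ENNReal.mul_lt_top (ENNReal.pow_lt_top hK) hgf

lemma memLp_resolventLeft (hκ : 0 < κ) (hg : MemLp g 2 volume) :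
    MemLp (resolventLeft κ g) 2 volume := by
  refine memLp_of_enorm_le_convolution hκ hg (continuous_resolventLeft hκ hg) fun x => ?_
  rw [resolventLeft, ← integral_smul]
  refine (enorm_integral_le_lintegral_enorm _).trans ?_
  refine le_trans (le_of_eq ?_) (setLIntegral_le_lintegral (Iic x) _)
  refine setLIntegral_congr_fun measurableSet_Iic fun y hy => ?_
  rw [smul_smul, ← Real.exp_add, enorm_smul, Real.enorm_of_nonneg (Real.exp_pos _).le,
    abs_of_nonneg (sub_nonneg.2 hy)]
  ring_nf

lemma memLp_resolventRight (hκ : 0 < κ) (hg : MemLp g 2 volume) :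
    MemLp (resolventRight κ g) 2 volume := by
  refine memLp_of_enorm_le_convolution hκ hg (continuous_resolventRight hκ hg) fun x => ?_
  rw [resolventRight, ← integral_smul]
  refine (enorm_integral_le_lintegral_enorm _).trans ?_
  refine le_trans (le_of_eq ?_) (setLIntegral_le_lintegral (Ioi x) _)
  refine setLIntegral_congr_fun measurableSet_Ioi fun y hy => ?_
  rw [smul_smul, ← Real.exp_add, enorm_smul, Real.enorm_of_nonneg (Real.exp_pos _).le,
    abs_of_nonpos (sub_nonpos.2 (le_of_lt hy))]
  ring_nf

/-- The equation `-u'' + κ² u = g` has a solution of class `H²(ℝ)` for every `g ∈ L²(ℝ)`. -/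
lemma W.exists_resolvent (hκ : 0 < κ) (g : Lp ℂ 2 (volume : Measure ℝ)) :
    ∃ u : W, HasJump u 0 ∧ W.secondDeriv u = ((κ ^ 2 : ℝ) : ℂ) • W.toL2 u - g := by
  have hg : MemLp g 2 volume := Lp.memLp g
  set P := resolventLeft κ g
  set Q := resolventRight κ g
  have mP : MemLp P 2 volume := memLp_resolventLeft hκ hg
  have mQ : MemLp Q 2 volume := memLp_resolventRight hκ hg
  have cP : Continuous P := continuous_resolventLeft hκ hg
  have cQ : Continuous Q := continuous_resolventRight hκ hg
  have hκ' : (κ : ℂ) ≠ 0 := by exact_mod_cast hκ.ne'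
  -- This is convolution with the Green function `exp (-κ |x|) / (2κ)`. From `P' = -κ P + g` and `Q'
  -- = κ Q - g` one gets `u' = (Q - P) / 2`, whose continuity excludes a jump.
  set u : ℝ → ℂ := (1 / (2 * κ) : ℂ) • (P + Q)
  set v : ℝ → ℂ := (1 / 2 : ℂ) • (Q + (-1 : ℂ) • P)
  set w : ℝ → ℂ := ((κ ^ 2 : ℝ) : ℂ) • u - g
  have hu : ∀ {I : Set ℝ}, IsOpen I → HasWeakDerivOn I u v := fun {I} hI => by
    have h := ((hasWeakDerivOn_resolventLeft hI hκ hg).add hI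
      (hasWeakDerivOn_resolventRight hI hκ hg)).smul (1 / (2 * κ))
    convert h using 1
    funext x
    simp only [v, P, Q, Pi.smul_apply, Pi.add_apply, smul_eq_mul]
    field_simp
    ring
  have hv : ∀ {I : Set ℝ}, IsOpen I → HasWeakDerivOn I v w := fun {I} hI => by
    have h := ((hasWeakDerivOn_resolventRight hI hκ hg).add hI
      ((hasWeakDerivOn_resolventLeft hI hκ hg).smul (-1))).smul (1 / 2)
    convert h using 1
    funext x
    simp only [w, u, P, Q, Pi.smul_apply, Pi.add_apply, Pi.sub_apply, smul_eq_mul]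
    push_cast
    field_simp
    ring
  have mu : MemLp u 2 volume := (mP.add mQ).const_smul _
  have mv : MemLp v 2 volume := (mQ.add (mP.const_smul _)).const_smul _
  have mw : MemLp w 2 volume := (mu.const_smul _).sub hg
  have mem : u ∈ W := ⟨(cP.add cQ).const_smul _,
    ⟨mu.restrict _, v, w, mv.restrict _, mw.restrict _, hu isOpen_Iio, hv isOpen_Iio⟩,
    ⟨mu.restrict _, v, w, mv.restrict _, mw.restrict _, hu isOpen_Ioi, hv isOpen_Ioi⟩⟩
  have cv : Continuous v := (cQ.add (cP.const_smul _)).const_smul _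
  refine ⟨⟨u, mem⟩, ⟨v 0, v 0, ⟨v, hu isOpen_Ioi, (cv.tendsto 0).mono_left nhdsWithin_le_nhds⟩,
    ⟨v, hu isOpen_Iio, (cv.tendsto 0).mono_left nhdsWithin_le_nhds⟩, by ring⟩, ?_⟩
  refine (W.isSecondDeriv _).unique ?_
  have e : w =ᵐ[volume] (((κ ^ 2 : ℝ) : ℂ) • W.toL2 ⟨u, mem⟩ - g : Lp ℂ 2 (volume : Measure ℝ)) := by
    have e0 : W.toL2 ⟨u, mem⟩ =ᵐ[volume] u := (W.memLp ⟨u, mem⟩).coeFn_toLp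
    filter_upwards [Lp.coeFn_sub (((κ ^ 2 : ℝ) : ℂ) • W.toL2 ⟨u, mem⟩) g,
      Lp.coeFn_smul ((κ ^ 2 : ℝ) : ℂ) (W.toL2 ⟨u, mem⟩), e0] with x h1 h2 h3
    rw [h1, Pi.sub_apply, h2, Pi.smul_apply, h3]
    rfl
  exact ⟨⟨v, hu isOpen_Iio, (hv isOpen_Iio).congr isOpen_Iio (ae_eq_refl _)
      (ae_restrict_of_ae e)⟩,
    ⟨v, hu isOpen_Ioi, (hv isOpen_Ioi).congr isOpen_Ioi (ae_eq_refl _) (ae_restrict_of_ae e)⟩⟩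

end Resolvent

/-! ### Boundary form and trace estimate for a single component -/

/-- The decay rate `√(n + 1/2)`. -/
def rate (n : ℕ) : ℝ := Real.sqrt (n + 1 / 2)

lemma rate_pos (n : ℕ) : 0 < rate n := Real.sqrt_pos.2 (by positivity)

lemma rate_sq (n : ℕ) : rate n ^ 2 = n + 1 / 2 := Real.sq_sqrt (by positivity)

lemma Lshift_eq (n : ℕ) (u : W) :
    Lshift n u = -W.secondDeriv u + ((rate n ^ 2 : ℝ) : ℂ) • W.toL2 u := by
  rw [rate_sq]
  simp only [Lshift, L, LinearMap.add_apply, LinearMap.neg_apply, LinearMap.smul_apply]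
  push_cast
  rw [add_smul]
  abel

/-- The zeroth-order term has a real coefficient and cancels, so only the boundary form of the
second derivative survives. -/
lemma inner_Lshift_sub (n : ℕ) {u v : W} {j k : ℂ} (hu : HasJump u j) (hv : HasJump v k) :
    inner ℂ (Lshift n u) (W.toL2 v) - inner ℂ (W.toL2 u) (Lshift n v) =
      conj j * (v : ℝ → ℂ) 0 - conj ((u : ℝ → ℂ) 0) * k := by
  have h := W.inner_secondDeriv_sub hu hv
  rw [Lshift_eq, Lshift_eq, inner_add_left, inner_add_right, inner_neg_left, inner_neg_right,
    inner_smul_left, inner_smul_right, Complex.conj_ofReal]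
  linear_combination -h

lemma exists_Lshift_eq (n : ℕ) (g : Lp ℂ 2 (volume : Measure ℝ)) :
    ∃ u : W, HasJump u 0 ∧ Lshift n u = g := by
  obtain ⟨u, hj, hu⟩ := W.exists_resolvent (rate_pos n) g
  refine ⟨u, hj, ?_⟩
  rw [Lshift_eq, hu]
  abel

lemma Lshift_exp (n : ℕ) {t : ℝ} (ht : 0 < t) :
    Lshift n (W.exp t ht) = ((rate n ^ 2 - t ^ 2 : ℝ) : ℂ) • W.toL2 (W.exp t ht) := by
  rw [Lshift_eq, W.secondDeriv_exp, Complex.ofReal_sub, sub_smul]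
  abel

lemma W.exp_zero {t : ℝ} (ht : 0 < t) : (W.exp t ht : ℝ → ℂ) 0 = 1 := expAbs_zero t

lemma W.hasJump_exp {t : ℝ} (ht : 0 < t) : HasJump (W.exp t ht) (-2 * t) := hasJump_expAbs t

/-- Green's formula against an exponential gives a linear equation for the value and the jump at
`0`. For `t = rate n` the bulk term disappears, and varying `t` separates the two unknowns. -/
lemma inner_exp_Lshift (n : ℕ) {t : ℝ} (ht : 0 < t) {u : W} {j : ℂ} (hu : HasJump u j) :
    inner ℂ (W.toL2 (W.exp t ht)) (Lshift n u) =
      ((rate n ^ 2 - t ^ 2 : ℝ) : ℂ) * inner ℂ (W.toL2 (W.exp t ht)) (W.toL2 u) +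
        2 * t * (u : ℝ → ℂ) 0 + j := by
  have h := inner_Lshift_sub n (W.hasJump_exp ht) hu
  rw [Lshift_exp, inner_smul_left, Complex.conj_ofReal, W.exp_zero] at h
  simp only [map_mul, map_neg, map_ofNat, Complex.conj_ofReal, map_one] at h
  linear_combination -h

/-- The trace estimate at the point `0`. -/
lemma norm_apply_zero_sq_le (n : ℕ) {u : W} {j : ℂ} (hu : HasJump u j) :
    ‖(u : ℝ → ℂ) 0‖ ^ 2 ≤ 8 * rate n * (‖W.toL2 u‖ ^ 2 + ‖Lshift n u‖ ^ 2) := by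
  have hκ := rate_pos n
  have hκ2 : 0 < 2 * rate n := by linarith
  set κ := rate n with hκdef
  set e₁ := W.toL2 (W.exp κ hκ)
  set e₂ := W.toL2 (W.exp (2 * κ) hκ2)
  set y := (u : ℝ → ℂ) 0
  set f := Lshift n u
  have h1 := inner_exp_Lshift n hκ hu
  have h2 := inner_exp_Lshift n hκ2 hu
  -- Subtracting the equations for `t = κ` and `t = 2κ` eliminates the jump, so the estimate
  -- involves no derivative data.
  have eq : (2 * κ : ℂ) * y =
      (3 * κ ^ 2 : ℂ) * inner ℂ e₂ (W.toL2 u) + inner ℂ e₂ f - inner ℂ e₁ f := by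
    simp only [← hκdef] at h1 h2
    rw [sub_self, Complex.ofReal_zero, zero_mul, zero_add] at h1
    push_cast at h2
    linear_combination h1 - h2
  have n1 : ‖e₁‖ ^ 2 = 1 / κ := W.norm_exp_sq hκ
  have n2 : ‖e₂‖ ^ 2 = 1 / (2 * κ) := W.norm_exp_sq hκ2
  set s := ‖e₁‖ with hs
  have hs0 : 0 ≤ s := norm_nonneg _
  have n21 : ‖e₂‖ ≤ s := by
    refine le_of_sq_le_sq ?_ hs0
    rw [n1, n2]
    gcongr
    linarith
  have c1 : ‖inner ℂ e₂ (W.toL2 u)‖ ≤ s * ‖W.toL2 u‖ :=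
    (norm_inner_le_norm _ _).trans (by gcongr)
  have c2 : ‖inner ℂ e₂ f‖ ≤ s * ‖f‖ := (norm_inner_le_norm _ _).trans (by gcongr)
  have c3 : ‖inner ℂ e₁ f‖ ≤ s * ‖f‖ := norm_inner_le_norm _ _
  have b : 2 * κ * ‖y‖ ≤ s * (3 * κ ^ 2 * ‖W.toL2 u‖ + 2 * ‖f‖) := by
    have e1 : ‖(2 * κ : ℂ) * y‖ = 2 * κ * ‖y‖ := by
      rw [norm_mul, norm_mul, Complex.norm_real, Real.norm_of_nonneg hκ.le]; simp
    have e2 : ‖(3 * κ ^ 2 : ℂ) * inner ℂ e₂ (W.toL2 u)‖ =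
        3 * κ ^ 2 * ‖inner ℂ e₂ (W.toL2 u)‖ := by
      rw [norm_mul, norm_mul, norm_pow, Complex.norm_real, Real.norm_of_nonneg hκ.le]; simp
    rw [← e1, eq]
    refine (norm_sub_le _ _).trans ((add_le_add_left (norm_add_le _ _) _).trans ?_)
    rw [e2]
    have := mul_le_mul_of_nonneg_left c1 (by positivity : 0 ≤ 3 * κ ^ 2)
    linarith
  have b2 : (2 * κ * ‖y‖) ^ 2 ≤ 1 / κ * (3 * κ ^ 2 * ‖W.toL2 u‖ + 2 * ‖f‖) ^ 2 := by
    rw [← n1, ← mul_pow]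
    exact pow_le_pow_left₀ (by positivity) b 2
  have hhalf : 1 / 2 ≤ κ ^ 2 := by
    rw [hκdef, rate_sq]
    have : (0 : ℝ) ≤ n := n.cast_nonneg
    linarith
  have b3 : 4 * κ ^ 3 * ‖y‖ ^ 2 ≤ (3 * κ ^ 2 * ‖W.toL2 u‖ + 2 * ‖f‖) ^ 2 := by
    have := mul_le_mul_of_nonneg_left b2 hκ.le
    rw [← mul_assoc, mul_one_div_cancel hκ.ne', one_mul] at this
    linarith [this, (by ring : κ * (2 * κ * ‖y‖) ^ 2 = 4 * κ ^ 3 * ‖y‖ ^ 2)]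
  have b4 : (3 * κ ^ 2 * ‖W.toL2 u‖ + 2 * ‖f‖) ^ 2 ≤
      32 * κ ^ 4 * (‖W.toL2 u‖ ^ 2 + ‖f‖ ^ 2) := by
    -- Since `κ² ≥ 1/2`, the coefficient `8` of `‖f‖²` is at most `32 κ⁴`, which also covers the `18
    -- κ⁴` in front of `‖u‖²`.
    have k4 : 1 / 4 ≤ κ ^ 4 := by nlinarith
    have := sq_nonneg (3 * κ ^ 2 * ‖W.toL2 u‖ - 2 * ‖f‖)
    have p1 : 0 ≤ κ ^ 4 * ‖W.toL2 u‖ ^ 2 := by positivity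
    have p2 := mul_le_mul_of_nonneg_right k4 (sq_nonneg ‖f‖)
    nlinarith
  have k3 : 0 < 4 * κ ^ 3 := by positivity
  refine le_of_mul_le_mul_left ?_ k3
  calc 4 * κ ^ 3 * ‖y‖ ^ 2 ≤ 32 * κ ^ 4 * (‖W.toL2 u‖ ^ 2 + ‖f‖ ^ 2) := b3.trans b4
    _ = _ := by ring

/-! ### The Jacobi matrix and the symmetry of the operator -/

/-- The right-hand side `√(n+1) xₙ₊₁ + √n xₙ₋₁` of the matching conditions. -/
def jacobi (x : ℕ → ℂ) (n : ℕ) : ℂ :=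
  (Real.sqrt (n + 1) : ℂ) * x (n + 1) + (Real.sqrt n : ℂ) * x (n - 1)

lemma conj_jacobi (x : ℕ → ℂ) (n : ℕ) : conj (jacobi x n) = jacobi (fun k => conj (x k)) n := by
  simp [jacobi]

/-- The discrete Green formula: the matrix is symmetric, so neighbouring terms telescope. Truncated
subtraction at index `0` is harmless because its coefficient is `√0`. -/
lemma sum_jacobi_sub (a b : ℕ → ℂ) (N : ℕ) :
    ∑ k ∈ Finset.range N, (jacobi a k * b k - a k * jacobi b k) =
      (Real.sqrt N : ℂ) * (a N * b (N - 1) - a (N - 1) * b N) := by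
  induction N with
  | zero => simp
  | succ N ih =>
    rw [Finset.sum_range_succ, ih]
    simp only [jacobi, Nat.add_sub_cancel]
    push_cast
    ring

lemma matching_iff {μ : ℝ} (hμ : μ ≠ 0) {u : ℕ → W} :
    Matching μ u ↔
      ∀ n, HasJump (u n) (jacobi (fun k => (u k : ℝ → ℂ) 0) n / μ) := by
  have hμ' : (μ : ℂ) ≠ 0 := by exact_mod_cast hμ
  refine forall_congr' fun n => exists_congr fun a => exists_congr fun b => ?_
  refine and_congr_right fun _ => and_congr_right fun _ => ?_
  rw [div_eq_iff hμ', mul_comm (a - b), jacobi, eq_comm]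

/-- A non-zero limit would force `σ N ≥ const / (N + 1)` eventually, contradicting divergence of the
harmonic series. -/
lemma eq_zero_of_tendsto_of_summable {T : ℕ → ℂ} {σ : ℕ → ℝ} {c : ℂ} (hσ : Summable σ)
    (hT : ∀ N : ℕ, ‖T (N + 1)‖ ≤ (N + 1 : ℝ) * σ N) (hc : Tendsto T atTop (𝓝 c)) : c = 0 := by
  by_contra hne
  have hpos : 0 < ‖c‖ := norm_pos_iff.2 hne
  have ht : Tendsto (fun N => ‖T (N + 1)‖) atTop (𝓝 ‖c‖) :=
    (hc.comp (tendsto_add_atTop_nat 1)).norm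
  have hev : ∀ᶠ N in atTop, ‖c‖ / 2 ≤ ‖T (N + 1)‖ :=
    (ht.eventually (lt_mem_nhds (half_lt_self hpos))).mono fun N h => h.le
  have hs : Summable fun N : ℕ => 1 / ((N + 1 : ℕ) : ℝ) := by
    refine Summable.of_norm_bounded_eventually_nat (g := fun N => 2 / ‖c‖ * σ N)
      (hσ.mul_left _) ?_
    filter_upwards [hev] with N hN
    have hN1 : (0 : ℝ) < N + 1 := by positivity
    have h := hN.trans (hT N)
    rw [Real.norm_of_nonneg (by positivity)]
    push_cast
    rw [div_le_iff₀ hN1]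
    have : 2 / ‖c‖ * (‖c‖ / 2) ≤ 2 / ‖c‖ * ((N + 1 : ℝ) * σ N) := by gcongr
    rw [div_mul_div_cancel₀ hpos.ne', div_self two_ne_zero] at this
    linarith
  exact Real.not_summable_one_div_natCast ((summable_nat_add_iff 1).1 hs)

lemma summable_norm_sq (U : H) : Summable fun n => ‖U n‖ ^ 2 := by
  simpa using (lp.memℓp U).summable (by norm_num)

/-- The matrix weight and the trace constant each grow like `√N`; their product is linear, just
within the reach of the harmonic series argument. -/
lemma sqrt_mul_rate_le (N : ℕ) : Real.sqrt (N + 1) * rate (N + 1) ≤ 2 * (N + 1) := by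
  have h1 : Real.sqrt (N + 1) ^ 2 = N + 1 := Real.sq_sqrt (by positivity)
  have h2 : rate (N + 1) ^ 2 = N + 1 + 1 / 2 := by rw [rate_sq]; push_cast; ring
  have h3 : (0 : ℝ) ≤ N := N.cast_nonneg
  nlinarith [sq_nonneg (Real.sqrt (N + 1) - rate (N + 1))]

lemma rate_le_succ (N : ℕ) : rate N ≤ rate (N + 1) :=
  Real.sqrt_le_sqrt (by push_cast; linarith)

/-- The operator `A_α` is symmetric. -/
theorem A_isFormalAdjoint {α : ℝ} (hα : 0 < α) : (A α).IsFormalAdjoint (A α) := by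
  intro U V
  have hμ : Real.sqrt 2 / α ≠ 0 := (div_pos (by positivity) hα).ne'
  set μ := Real.sqrt 2 / α with hμdef
  set u : ℕ → W := comp (α := α) U
  set v : ℕ → W := comp (α := α) V
  have hu : ∀ n, (U : H) n = W.toL2 (u n) := comp_spec (α := α) U
  have hv : ∀ n, (V : H) n = W.toL2 (v n) := comp_spec (α := α) V
  have ju := (matching_iff hμ).1 (comp_matching (α := α) U)
  have jv := (matching_iff hμ).1 (comp_matching (α := α) V)
  set x : ℕ → ℂ := fun k => (u k : ℝ → ℂ) 0 with hx
  set y : ℕ → ℂ := fun k => (v k : ℝ → ℂ) 0 with hy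
  have hμ' : (μ : ℂ) ≠ 0 := by exact_mod_cast hμ
  have hd : ∀ n, inner ℂ ((A α U : H) n) ((V : H) n) - inner ℂ ((U : H) n) ((A α V : H) n) =
      (1 / μ : ℂ) * (jacobi (fun k => conj (x k)) n * y n - conj (x n) * jacobi y n) := by
    intro n
    rw [A_apply U u hu, A_apply V v hv, hu, hv, inner_Lshift_sub n (ju n) (jv n), map_div₀,
      conj_jacobi, Complex.conj_ofReal]
    ring
  have hsum := (lp.hasSum_inner (𝕜 := ℂ) (A α U) (V : H)).sub
    (lp.hasSum_inner (𝕜 := ℂ) (U : H) (A α V))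
  simp only [hd] at hsum
  have ht := hsum.tendsto_sum_nat
  -- The partial sums of the symmetry defect become Wronskian terms, and their limit is the defect
  -- itself.
  simp only [← Finset.mul_sum, sum_jacobi_sub] at ht
  rw [← sub_eq_zero]
  set s : ℕ → ℝ := fun n => ‖(U : H) n‖ ^ 2 + ‖(A α U : H) n‖ ^ 2 with hs
  set r : ℕ → ℝ := fun n => ‖(V : H) n‖ ^ 2 + ‖(A α V : H) n‖ ^ 2 with hr
  have ss : Summable s := (summable_norm_sq _).add (summable_norm_sq _)
  have sr : Summable r := (summable_norm_sq _).add (summable_norm_sq _)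
  have bx : ∀ n, ‖x n‖ ^ 2 ≤ 8 * rate n * s n := fun n => by
    have := norm_apply_zero_sq_le n (ju n)
    rwa [← hu, ← A_apply U u hu] at this
  have hyb : ∀ n, ‖y n‖ ^ 2 ≤ 8 * rate n * r n := fun n => by
    have := norm_apply_zero_sq_le n (jv n)
    rwa [← hv, ← A_apply V v hv] at this
  have s0 : ∀ n, 0 ≤ s n := fun n => by positivity
  have r0 : ∀ n, 0 ≤ r n := fun n => by positivity
  refine eq_zero_of_tendsto_of_summable (σ := fun N => ‖(1 / μ : ℂ)‖ *
    (8 * (s (N + 1) + r N + (s N + r (N + 1))))) ?_ (fun N => ?_) ht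
  · exact (((((summable_nat_add_iff 1).2 ss).add sr).add
      (ss.add ((summable_nat_add_iff 1).2 sr))).mul_left 8).mul_left _
  · rw [norm_mul, norm_mul, Complex.norm_real, Real.norm_of_nonneg (Real.sqrt_nonneg _),
      Nat.add_sub_cancel, mul_left_comm ((N : ℝ) + 1)]
    refine mul_le_mul_of_nonneg_left ?_ (norm_nonneg _)
    -- Each product is split by `2ab ≤ a² + b²` before the trace estimate is applied, hence half of
    -- the constant `8`.
    have hn : ‖conj (x (N + 1)) * y N - conj (x N) * y (N + 1)‖ ≤
        4 * rate (N + 1) * (s (N + 1) + r N + (s N + r (N + 1))) := by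
      refine (norm_sub_le _ _).trans ?_
      rw [norm_mul, norm_mul, RCLike.norm_conj, RCLike.norm_conj]
      have m1 : 8 * rate N * s N ≤ 8 * rate (N + 1) * s N := by
        have := rate_le_succ N
        have := s0 N
        gcongr
      have m2 : 8 * rate N * r N ≤ 8 * rate (N + 1) * r N := by
        have := rate_le_succ N
        have := r0 N
        gcongr
      nlinarith [sq_nonneg (‖x (N + 1)‖ - ‖y N‖), sq_nonneg (‖x N‖ - ‖y (N + 1)‖),
        bx N, bx (N + 1), hyb N, hyb (N + 1)]
    have hS : 0 ≤ s (N + 1) + r N + (s N + r (N + 1)) := by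
      have := s0 N; have := s0 (N + 1); have := r0 N; have := r0 (N + 1)
      linarith
    have hq := sqrt_mul_rate_le N
    push_cast
    calc Real.sqrt (N + 1) * ‖conj (x (N + 1)) * y N - conj (x N) * y (N + 1)‖
        ≤ Real.sqrt (N + 1) * (4 * rate (N + 1) * (s (N + 1) + r N + (s N + r (N + 1)))) := by
          gcongr
      _ = 4 * (Real.sqrt (N + 1) * rate (N + 1)) * (s (N + 1) + r N + (s N + r (N + 1))) := by
          ring
      _ ≤ 4 * (2 * (N + 1)) * (s (N + 1) + r N + (s N + r (N + 1))) := by gcongr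
      _ = _ := by ring

/-! ### Finite test sequences and maximality -/

lemma HasJump.zero : HasJump 0 0 :=
  ⟨0, 0, ⟨0, HasWeakDerivOn.zero, tendsto_const_nhds⟩, ⟨0, HasWeakDerivOn.zero, tendsto_const_nhds⟩,
    by simp⟩

/-- Finitely supported sequences in `𝒲(ℝ)` with the matching conditions lie in the domain of
`A_α⁰`. -/
lemma exists_mem_domain_A0 {α : ℝ} {u : ℕ → W} {N : ℕ} (hN : ∀ n, N ≤ n → u n = 0)
    (hm : Matching (Real.sqrt 2 / α) u) :
    ∃ U : (A0 α).domain, (∀ n, (U : H) n = W.toL2 (u n)) ∧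
      ∀ n, (A0 α U : H) n = Lshift n (u n) := by
  have hmem : Memℓp (fun n => W.toL2 (u n)) 2 := by
    refine memℓp_gen (summable_of_ne_finset_zero (s := Finset.range N) fun n hn => ?_)
    rw [hN n (by simpa using hn)]
    simp
  set U : H := ⟨fun n => W.toL2 (u n), hmem⟩ with hUdef
  have hU : ∀ n, U n = W.toL2 (u n) := fun n => rfl
  have hdom : U ∈ dom α := by
    refine ⟨u, hU, hm, summable_of_ne_finset_zero (s := Finset.range N) fun n hn => ?_⟩
    rw [hN n (by simpa using hn)]
    simp
  have hfin : U ∈ finSupp := by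
    refine (Set.finite_lt_nat N).subset fun n hn => ?_
    by_contra h
    exact hn (by rw [hU, hN n (not_lt.1 h), map_zero])
  refine ⟨⟨U, hfin, hdom⟩, hU, fun n => ?_⟩
  have e : A0 α ⟨U, hfin, hdom⟩ = A α ⟨U, hdom⟩ := LinearPMap.domRestrict_apply rfl
  rw [e]
  exact A_apply ⟨U, hdom⟩ u hU n

section Maximality

variable {α : ℝ} {V F : H}

lemma sum_inner_eq_of_weak (h : ∀ U : (A0 α).domain, inner ℂ F (U : H) = inner ℂ V (A0 α U))
    {u : ℕ → W} {N : ℕ} (hN : ∀ n, N ≤ n → u n = 0) (hm : Matching (Real.sqrt 2 / α) u) :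
    ∑ n ∈ Finset.range N, inner ℂ (F n) (W.toL2 (u n)) =
      ∑ n ∈ Finset.range N, inner ℂ (V n) (Lshift n (u n)) := by
  obtain ⟨U, hU, hAU⟩ := exists_mem_domain_A0 hN hm
  have e := h U
  rw [lp.inner_eq_tsum, lp.inner_eq_tsum] at e
  simp only [hU, hAU] at e
  rwa [tsum_eq_sum (s := Finset.range N) fun n hn => by rw [hN n (by simpa using hn)]; simp,
    tsum_eq_sum (s := Finset.range N) fun n hn => by rw [hN n (by simpa using hn)]; simp] at e

/-- A function with zero value and zero jump does not enter the matching conditions, so it may be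
placed alone in any component; this decouples the weak equation. -/
lemma inner_component_eq_of_weak (hα : 0 < α)
    (h : ∀ U : (A0 α).domain, inner ℂ F (U : H) = inner ℂ V (A0 α U)) (n : ℕ) {w : W}
    (hw : HasJump w 0) (hw0 : (w : ℝ → ℂ) 0 = 0) :
    inner ℂ (F n) (W.toL2 w) = inner ℂ (V n) (Lshift n w) := by
  have hμ : Real.sqrt 2 / α ≠ 0 := (div_pos (by positivity) hα).ne'
  have hz : ∀ k, ((Pi.single n w : ℕ → W) k : ℝ → ℂ) 0 = 0 := fun k => by
    rcases eq_or_ne k n with rfl | hk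
    · simpa using hw0
    · simp [Pi.single_eq_of_ne hk]
  have hm : Matching (Real.sqrt 2 / α) (Pi.single n w) := by
    rw [matching_iff hμ]
    intro k
    have : jacobi (fun k => ((Pi.single n w : ℕ → W) k : ℝ → ℂ) 0) k / (Real.sqrt 2 / α : ℝ) = 0 := by
      simp [jacobi, hz]
    rw [this]
    rcases eq_or_ne k n with rfl | hk
    · simpa using hw
    · rw [Pi.single_eq_of_ne hk]
      exact .zero
  have e := sum_inner_eq_of_weak h (N := n + 1)
    (fun k hk => Pi.single_eq_of_ne (by omega) _) hm
  rw [Finset.sum_eq_single_of_mem n (by simp) fun k _ hk => by simp [Pi.single_eq_of_ne hk],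
    Finset.sum_eq_single_of_mem n (by simp) fun k _ hk => by simp [Pi.single_eq_of_ne hk]] at e
  simpa using e

/-- The admissible test functions `w` have images `(L + n) w` that exhaust the orthogonal complement
of the decaying exponential `e`. So `V n` minus a particular solution lies in the double complement,
the line spanned by `e`, on which `L + n` vanishes. -/
lemma exists_component_of_weak (hα : 0 < α)
    (h : ∀ U : (A0 α).domain, inner ℂ F (U : H) = inner ℂ V (A0 α U)) (n : ℕ) :
    ∃ v : W, V n = W.toL2 v ∧ Lshift n v = F n ∧ ∃ j, HasJump v j := by
  obtain ⟨r, hr, hrF⟩ := exists_Lshift_eq n (F n)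
  set e := W.exp (rate n) (rate_pos n)
  have hLe : Lshift n e = 0 := by simp [e, Lshift_exp]
  have horth : V n - W.toL2 r ∈ (ℂ ∙ W.toL2 e)ᗮᗮ := by
    intro g hg
    rw [Submodule.mem_orthogonal_singleton_iff_inner_right] at hg
    obtain ⟨w, hw, rfl⟩ := exists_Lshift_eq n g
    -- For jump-free `w`, pairing `(L + n) w` with `e` gives `2 · rate n · w(0)`; orthogonality to
    -- `e` thus means `w(0) = 0`.
    have hw0 : (w : ℝ → ℂ) 0 = 0 := by
      have h1 := inner_exp_Lshift n (rate_pos n) hw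
      rw [hg, sub_self, Complex.ofReal_zero, zero_mul, zero_add, add_zero] at h1
      have : (2 * rate n : ℂ) ≠ 0 := by
        have := (rate_pos n).ne'
        exact mul_ne_zero two_ne_zero (by exact_mod_cast this)
      exact (mul_eq_zero.1 h1.symm).resolve_left this
    have h2 := inner_component_eq_of_weak hα h n hw hw0
    have h3 := inner_Lshift_sub n hr hw
    rw [hrF, hw0] at h3
    have h4 : inner ℂ (V n - W.toL2 r) (Lshift n w) = 0 := by
      rw [inner_sub_left, ← h2]
      simpa using h3
    rw [← inner_conj_symm, h4, map_zero]
  rw [Submodule.orthogonal_orthogonal, Submodule.mem_span_singleton] at horth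
  obtain ⟨c, hc⟩ := horth
  refine ⟨r + c • e, ?_, ?_, _, hr.add ((W.hasJump_exp (rate_pos n)).smul c)⟩
  · rw [map_add, map_smul, hc]
    abel
  · rw [map_add, map_smul, hLe, hrF, smul_zero, add_zero]

/-- An element of `𝒲(ℝ)` with the value `1` at `0` and no jump of the derivative. -/
def unitValue : W := (2 : ℂ) • W.exp 1 one_pos + (-1 : ℂ) • W.exp 2 two_pos

/-- An element of `𝒲(ℝ)` with the value `0` at `0` and the jump `1` of the derivative. -/
def unitJump : W := (1 / 2 : ℂ) • W.exp 1 one_pos + (-1 / 2 : ℂ) • W.exp 2 two_pos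

lemma unitValue_zero : (unitValue : ℝ → ℂ) 0 = 1 := by
  simp [unitValue, W.exp_zero]
  norm_num

lemma unitJump_zero : (unitJump : ℝ → ℂ) 0 = 0 := by
  simp [unitJump, W.exp_zero]
  norm_num

lemma hasJump_unitValue : HasJump unitValue 0 := by
  have h := ((W.hasJump_exp one_pos).smul 2).add ((W.hasJump_exp two_pos).smul (-1))
  change HasJump unitValue _ at h
  convert h using 1
  push_cast
  norm_num

lemma hasJump_unitJump : HasJump unitJump 1 := by
  have h := ((W.hasJump_exp one_pos).smul (1 / 2)).add ((W.hasJump_exp two_pos).smul (-1 / 2))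
  change HasJump unitJump _ at h
  convert h using 1
  push_cast
  norm_num

/-- The operator `A_α` contains every operator adjoint to `A_α⁰`. -/
lemma mem_dom_of_weak (hα : 0 < α)
    (h : ∀ U : (A0 α).domain, inner ℂ F (U : H) = inner ℂ V (A0 α U)) :
    ∃ hV : V ∈ (A α).domain, A α ⟨V, hV⟩ = F := by
  have hμ : Real.sqrt 2 / α ≠ 0 := (div_pos (by positivity) hα).ne'
  choose v hv hvF j hj using exists_component_of_weak hα h
  have hm : Matching (Real.sqrt 2 / α) v := by
    rw [matching_iff hμ]
    intro n
    set μ := Real.sqrt 2 / α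
    set x : ℕ → ℂ := fun k => (v k : ℝ → ℂ) 0
    set y : ℕ → ℂ := Pi.single n 1 with hy
    -- Values and jumps are prescribed independently, so any finite sequence of values extends to an
    -- admissible one. For the unit sequence at `n`, the jumps reach index `n + 1`, hence the
    -- cut-off `n + 2` below.
    set u : ℕ → W := fun k => y k • unitValue + (jacobi y k / μ) • unitJump with hudef
    have y0 : ∀ k, n < k → y k = 0 := fun k hk => Pi.single_eq_of_ne hk.ne' _
    have huy : ∀ k, (u k : ℝ → ℂ) 0 = y k := fun k => by
      simp [hudef, unitValue_zero, unitJump_zero]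
    have huj : ∀ k, HasJump (u k) (jacobi y k / μ) := fun k => by
      have := (hasJump_unitValue.smul (y k)).add (hasJump_unitJump.smul (jacobi y k / μ))
      simpa using! this
    have hum : Matching μ u := by
      rw [matching_iff hμ]
      simpa only [huy] using huj
    have hu0 : ∀ k, n + 2 ≤ k → u k = 0 := fun k hk => by
      simp [hudef, jacobi, y0 k (by omega), y0 (k + 1) (by omega), y0 (k - 1) (by omega)]
    have e := sum_inner_eq_of_weak h hu0 hum
    rw [← sub_eq_zero, ← Finset.sum_sub_distrib] at e
    have hterm : ∀ k, inner ℂ (F k) (W.toL2 (u k)) - inner ℂ (V k) (Lshift k (u k)) =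
        (conj (j k) - jacobi (fun i => conj (x i)) k / μ) * y k +
          (1 / μ : ℂ) * (jacobi (fun i => conj (x i)) k * y k - conj (x k) * jacobi y k) :=
      fun k => by
        rw [← hvF, hv, inner_Lshift_sub k (hj k) (huj k), huy]
        ring
    simp only [hterm] at e
    -- The Wronskian at `n + 2` vanishes because `y` is zero there and at `n + 1`; what remains is
    -- the conjugated matching condition at `n`.
    rw [Finset.sum_add_distrib, ← Finset.mul_sum, sum_jacobi_sub,
      Finset.sum_eq_single_of_mem n (by simp) fun k _ hk => by simp [hy, Pi.single_eq_of_ne hk],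
      y0 (n + 2) (by omega), y0 (n + 2 - 1) (by omega)] at e
    simp only [hy, Pi.single_eq_same, mul_one, mul_zero, sub_self, add_zero] at e
    have ej : j n = jacobi x n / μ := by
      have := congrArg conj (sub_eq_zero.1 e)
      rw [Complex.conj_conj, map_div₀, Complex.conj_ofReal, conj_jacobi] at this
      simpa using this
    rw [← ej]
    exact hj n
  have hV : V ∈ dom α := ⟨v, hv, hm, by simpa only [hvF] using summable_norm_sq F⟩
  refine ⟨hV, ?_⟩
  ext1
  funext n
  rw [A_apply ⟨V, hV⟩ v hv n, hvF]

end Maximality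

/-! ### Density, self-adjointness and the closure -/

lemma A0_le_A (α : ℝ) : A0 α ≤ A α := LinearPMap.domRestrict_le

/-- A vector `F` orthogonal to the domain satisfies the weak equation with `V = 0`, so maximality
gives `F = A 0 = 0`. -/
lemma dense_domain_A0 {α : ℝ} (hα : 0 < α) : Dense ((A0 α).domain : Set H) := by
  rw [Submodule.dense_iff_topologicalClosure_eq_top, Submodule.topologicalClosure_eq_top_iff,
    Submodule.eq_bot_iff]
  intro F hF
  obtain ⟨hV, e⟩ := mem_dom_of_weak (V := 0) (F := F) hα fun U => by
    rw [inner_zero_left]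
    exact Submodule.inner_left_of_mem_orthogonal U.2 hF
  rw [← e]
  exact (A α).map_zero

/-- Symmetry gives `A ⊆ A*`. Conversely, an adjoint pair of `A` is in particular one of the smaller
operator `A0`, to which maximality applies. -/
theorem A_isSelfAdjoint {α : ℝ} (hα : 0 < α) : IsSelfAdjoint (A α) := by
  have hdense : Dense ((A α).domain : Set H) := (dense_domain_A0 hα).mono (A0_le_A α).1
  rw [LinearPMap.isSelfAdjoint_def]
  refine le_antisymm ?_ ((A_isFormalAdjoint hα).le_adjoint hdense)
  have key : ∀ y : (A α).adjoint.domain, ∃ hy : (y : H) ∈ (A α).domain,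
      A α ⟨y, hy⟩ = (A α).adjoint y := fun y =>
    mem_dom_of_weak hα fun U => by
      have := LinearPMap.adjoint_isFormalAdjoint hdense y ⟨U, (A0_le_A α).1 U.2⟩
      rwa [← (A0_le_A α).2 (x := U) (y := ⟨U, (A0_le_A α).1 U.2⟩) rfl] at this
  refine ⟨fun y hy => (key ⟨y, hy⟩).1, fun y z hyz => ?_⟩
  obtain ⟨hy, e⟩ := key y
  rw [← e]
  congr 1
  exact Subtype.ext hyz

theorem A0_isClosable {α : ℝ} (hα : 0 < α) : (A0 α).IsClosable :=
  (A_isSelfAdjoint hα).isClosed.isClosable.leIsClosable (A0_le_A α)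

/-- The graph of `A_α` lies in the closure of the graph of `A_α⁰`. -/
lemma graph_A_le {α : ℝ} (hα : 0 < α) : (A α).graph ≤ (A0 α).graph.topologicalClosure := by
  rintro ⟨x, z⟩ hxz
  rw [LinearPMap.mem_graph_iff] at hxz
  obtain ⟨X, rfl, rfl⟩ := hxz
  -- The product is given its Hilbert norm so that the closure of the graph is its double orthogonal
  -- complement.
  set ι := (WithLp.linearEquiv 2 ℂ (H × H)).symm
  set G : Submodule ℂ (WithLp 2 (H × H)) := (A0 α).graph.map ι.toLinearMap with hG
  have hmem : WithLp.toLp 2 ((X : H), A α X) ∈ G.topologicalClosure := by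
    rw [← Submodule.orthogonal_orthogonal_eq_closure]
    intro p hp
    -- Orthogonality to the graph of `A0` says that `(p.snd, -p.fst)` is an adjoint pair, so `A
    -- p.snd = -p.fst`; symmetry of `A` then makes `p` orthogonal to the graph of `A`.
    have hp' : ∀ U : (A0 α).domain, inner ℂ (-p.fst) (U : H) = inner ℂ p.snd (A0 α U) := fun U => by
      have := Submodule.inner_left_of_mem_orthogonal (K := G)
        (u := WithLp.toLp 2 ((U : H), A0 α U)) ⟨_, (A0 α).mem_graph U, rfl⟩ hp
      rw [WithLp.prod_inner_apply] at this
      rw [inner_neg_left]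
      exact neg_eq_of_add_eq_zero_right this
    obtain ⟨hV, e⟩ := mem_dom_of_weak hα hp'
    rw [WithLp.prod_inner_apply]
    have s := A_isFormalAdjoint hα ⟨p.snd, hV⟩ X
    rw [e, inner_neg_left] at s
    change inner ℂ p.fst (X : H) + inner ℂ p.snd (A α X) = 0
    rw [← s, add_neg_cancel]
  have := map_mem_closure (WithLp.prod_continuous_ofLp 2 H H) hmem
    (t := ((A0 α).graph : Set (H × H))) (by
      rintro _ ⟨q, hq, rfl⟩
      exact hq)
  exact this

theorem A0_closure_eq {α : ℝ} (hα : 0 < α) : (A0 α).closure = A α := by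
  have hc := A0_isClosable hα
  refine LinearPMap.eq_of_eq_graph ?_
  rw [← hc.graph_closure_eq_closure_graph]
  refine le_antisymm ?_ (graph_A_le hα)
  exact Submodule.topologicalClosure_minimal _ (LinearPMap.le_graph_of_le (A0_le_A α))
    (A_isSelfAdjoint hα).isClosed

end Smilansky

end

theorem theorem4p1 (α : ℝ) (hα : 0 < α) :
    IsSelfAdjoint (Smilansky.A α) ∧
      (Smilansky.A0 α).IsClosable ∧ (Smilansky.A0 α).closure = Smilansky.A α :=
  ⟨Smilansky.A_isSelfAdjoint hα, Smilansky.A0_isClosable hα, Smilansky.A0_closure_eq hα⟩
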